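/- **Setting.** The state $\omega\in[0,1]$ is drawn from a common prior $\mu_F$ with a strictly positive density $f$. Receiver has three actions $a_0,a_1,a_2$; there are cutoffs $0=\gamma_0\le\gamma_1\le\gamma_2\le\gamma_3=1$ such that $a_i$ is optimal for Receiver if and only if her posterior mean of the state lies in $A_i=[\gamma_i,\gamma_{i+1}]$. Sender's payoff depends only on the action, with $0=v(a_0)<v(a_1)<v(a_2)$. Let $\mathcal C$ be the set of nonempty closed subsets of $[0,1]$, with the Hausdorff distance. In the verifiable disclosure game Sender observes $\omega$ and sends a (possibly random) message $m\in\mathcal C$ with $\omega\in m$; Receiver observes $m$ and chooses a (possibly mixed) action. A (perfect Bayesian) equilibrium is a triple of probability kernels: $\sigma$ from $[0,1]$ to $\mathcal C$ (Sender's strategy, using only messages $m\ni\omega$ in state $\omega$), $\tau$ from $\mathcal C$ to $\{a_0,a_1,a_2\}$ (Receiver's strategy) and $p$ from $\mathcal C$ to $[0,1]$ (Receiver's belief), such that (i) for every $\omega$, $\sigma(\omega)$-almost every message maximizes $v(\tau(m))$ over all $m\in\mathcal C$ with $\omega\in m$, where $v(\tau(m))$ is Sender's expected payoff from $m$; (ii)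 $\tau(a_i\mid m)>0$ implies that the mean of $p(m)$ lies in $A_i$; (iii) $p(m)$ is supported on $m$; (iv) $p$ is obtained from $\mu_F$ and $\sigma$ by Bayes' rule. Its outcome is the pair $(G,R)$, where $G$ is the distribution of Receiver's posterior mean and $R$ is Sender's ex ante payoff. An equilibrium is Sender-preferred if its $R$ is maximal among all equilibria. Let $u(x)=\max\{v(a_i): x\in A_i\}$. A commitment outcome is a pair $(G,R)$ such that $G$ maximizes $\int u\,dG$ over all mean-preserving contractions of the prior and $R$ is the maximum. An equilibrium is an obedient recommendation equilibrium (ORE) defined by closed sets $B_0,B_1,B_2$ that cover $[0,1]$ and have pairwise $\mu_F$-null intersections if every state $\omega\in B_i\setminus\bigcup_{j>i}B_j$ sends the message $B_i$ with probability one and Receiver answers the message $B_i$ by $a_i$ with probability one. **Claim.** A Sender-preferred equilibrium exists, and at least one of the following holds. 1. The outcome of every Sender-preferred equilibrium is a commitment outcome. 2. There are $h$ and $y$ with $0<h<\gamma_2$ and $0\le y\le h$ that solve $$\mathbb E\big[\omega\mid\omega\in[h,\gamma_2]\big]=\gamma_1,\qquad \mathbb E\big[\omega\mid\omega\in[y,h]\cup[\gamma_2,1]\big]=\gamma_2,$$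 and there is an ORE defined by $$B_0=[0,y],\qquad B_1=[h,\gamma_2],\qquad B_2=[y,h]\cup[\gamma_2,1]$$ that is a Sender-preferred equilibrium. Moreover, the outcome of every Sender-preferred equilibrium agrees with the outcome of this ORE up to what is disclosed about the states in which $a_0$ is taken: it has the same $R$, and its $G$ gives the same probability to every Borel subset of $[\gamma_1,\infty)$. -/

import Mathlib

open MeasureTheory ProbabilityTheory Set
open scoped ENNReal

namespace VerifiableDisclosure

noncomputable section

/-- The state space `Ω = [0,1]`. -/
abbrev State : Type := unitInterval

/-- Messages are the nonempty closed (equivalently, compact) subsets of `[0,1]`, with the topology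
of the Hausdorff distance. A message `m` is feasible in state `ω` iff `ω ∈ m`. -/
abbrev Message : Type := TopologicalSpace.NonemptyCompacts State

instance : MeasurableSpace Message := borel Message

instance : BorelSpace Message := ⟨rfl⟩

/-- The primitives with `n` actions `a_0, …, a_{n-1}`: a strictly positive density `f` of the common
prior on `[0,1]`, cutoffs `0 = γ_0 ≤ γ_1 ≤ ⋯ ≤ γ_n = 1`, and Sender's strictly increasing
payoff `v` over Receiver's actions, normalized by `v(a_0) = 0`. -/
structure Environment (n : ℕ) where
  f : State → ℝ
  f_measurable : Measurable f
  f_pos : ∀ ω, 0 < f ω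
  f_total : ∫⁻ ω, ENNReal.ofReal (f ω) = 1
  γ : Fin (n + 1) → ℝ
  γ_mono : Monotone γ
  γ_zero : γ 0 = 0
  γ_last : γ (Fin.last n) = 1
  v : Fin n → ℝ
  v_strictMono : StrictMono v
  v_zero : ∀ i : Fin n, i.val = 0 → v i = 0

/-- Sender's strategy `σ`, Receiver's strategy `τ`, and Receiver's belief system `p`. In every state
Sender's strategy only uses messages that contain the state. -/
structure Assessment (n : ℕ) where
  σ : Kernel State Message
  τ : Kernel Message (Fin n)
  p : Kernel Message State
  markov_σ : IsMarkovKernel σ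
  markov_τ : IsMarkovKernel τ
  markov_p : IsMarkovKernel p
  feasible : ∀ ω, ∀ᵐ m ∂(σ ω), ω ∈ m

namespace Environment

variable {n : ℕ}

/-- The prior `μ_F`. -/
def prior (E : Environment n) : Measure State :=
  volume.withDensity fun ω => ENNReal.ofReal (E.f ω)

instance (E : Environment n) : IsProbabilityMeasure E.prior :=
  ⟨by rw [prior, withDensity_apply _ MeasurableSet.univ, Measure.restrict_univ]; exact E.f_total⟩

/-- `A_i = [γ_i, γ_{i+1}]`, the posterior means at which action `a_i` is optimal for Receiver. -/
def A (E : Environment n) (i : Fin n) : Set ℝ := Icc (E.γ i.castSucc) (E.γ i.succ)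

/-- `E[ω | ω ∈ B]` under the prior. -/
def condMean (E : Environment n) (B : Set State) : ℝ := ∫ ω, (ω : ℝ) ∂(cond E.prior B)

/-- Receiver's posterior mean of the state after message `m`. -/
def posteriorMean (e : Assessment n) (m : Message) : ℝ := ∫ ω, (ω : ℝ) ∂(e.p m)

/-- `v(τ(m))`, Sender's expected payoff from message `m`. -/
def payoff (E : Environment n) (e : Assessment n) (m : Message) : ℝ := ∫ a, E.v a ∂(e.τ m)

/-- Perfect Bayesian equilibrium of the verifiable disclosure game. -/
structure IsEquilibrium (E : Environment n) (e : Assessment n) : Prop where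
  sender : ∀ ω, ∀ᵐ m ∂(e.σ ω), ∀ m' : Message, ω ∈ m' → E.payoff e m' ≤ E.payoff e m
  receiver : ∀ m i, 0 < e.τ m {i} → posteriorMean e m ∈ E.A i
  /-- States in which `m` is not available are outside of the support of the belief `p(m)`. -/
  verifiable : ∀ m : Message, e.p m (m : Set State)ᶜ = 0
  /-- Bayes' rule: `p` disintegrates the joint law of messages and states. -/
  bayes : (E.prior ⊗ₘ e.σ).map Prod.swap = (e.σ ∘ₘ E.prior) ⊗ₘ e.p

/-- The outcome `(G, R)`: the law `G` of Receiver's posterior mean, and Sender's ex ante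
payoff `R`. -/
def outcome (E : Environment n) (e : Assessment n) : Measure ℝ × ℝ :=
  ((e.σ ∘ₘ E.prior).map (posteriorMean e), ∫ m, E.payoff e m ∂(e.σ ∘ₘ E.prior))

/-- An equilibrium with the highest Sender ex ante payoff among all equilibria. -/
def IsSenderPreferred (E : Environment n) (e : Assessment n) : Prop :=
  E.IsEquilibrium e ∧ ∀ e', E.IsEquilibrium e' → (E.outcome e').2 ≤ (E.outcome e).2

/-- Sender's value function: her payoff at posterior mean `x` when Receiver takes Sender's
favorite among the actions that are optimal for Receiver at `x`. -/
def u (E : Environment n) (x : ℝ) : ℝ := sSup (E.v '' {i | x ∈ E.A i})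

/-- `G` is a distribution on `[0,1]` that is a mean-preserving contraction of the prior. -/
structure IsMPC (E : Environment n) (G : Measure ℝ) : Prop where
  prob : IsProbabilityMeasure G
  supp : G (Icc 0 1)ᶜ = 0
  le : ∀ x ∈ Icc (0 : ℝ) 1,
    ∫ s in (0 : ℝ)..x, cdf G s ≤ ∫ s in (0 : ℝ)..x, cdf (E.prior.map Subtype.val) s
  eq : ∫ s in (0 : ℝ)..1, cdf G s = ∫ s in (0 : ℝ)..1, cdf (E.prior.map Subtype.val) s

/-- `(G, R)` is a commitment outcome: `G` maximizes `∫ u dG` among the mean-preserving contractions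
of the prior, and `R` is the maximum. -/
def IsCommitmentOutcome (E : Environment n) (o : Measure ℝ × ℝ) : Prop :=
  E.IsMPC o.1 ∧ (∀ G, E.IsMPC G → ∫ x, E.u x ∂G ≤ ∫ x, E.u x ∂o.1) ∧ o.2 = ∫ x, E.u x ∂o.1

/-- Closed sets that cover `[0,1]` and overlap only in null sets. -/
structure IsDeterministicRepresentation (E : Environment n) (B : Fin n → Set State) : Prop where
  closed : ∀ i, IsClosed (B i)
  cover : ⋃ i, B i = univ
  null : ∀ i j, i ≠ j → E.prior (B i ∩ B j) = 0

/-- `e` is an obedient recommendation equilibrium defined by `B`: it is an equilibrium, every state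
in `B_i` outside of all `B_j` with `j > i` sends the message `B_i`, and Receiver answers the
message `B_i` by `a_i`. -/
structure IsORE (E : Environment n) (e : Assessment n) (B : Fin n → Set State) : Prop where
  equilibrium : E.IsEquilibrium e
  representation : E.IsDeterministicRepresentation B
  message : ∀ i ω, ω ∈ B i → (∀ j, i < j → ω ∉ B j) → e.σ ω {m | (m : Set State) = B i} = 1
  action : ∀ i (m : Message), (m : Set State) = B i → e.τ m {i} = 1

end Environment

/-- A set of reals viewed as a set of states. -/
def states (S : Set ℝ) : Set State := {ω | (ω : ℝ) ∈ S}

/-- `B_0 = [0, y]`, `B_1 = [h, g]`, `B_2 = [y, h] ∪ [g, 1]`. -/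
def nestedRep (y h g : ℝ) : Fin 3 → Set State :=
  ![states (Icc 0 y), states (Icc h g), states (Icc y h ∪ Icc g 1)]

end

end VerifiableDisclosure

namespace VerifiableDisclosure

noncomputable section

/-! Write c₁, c₂ for `E.γ 1`, `E.γ 2`. The candidates are the nested recommendations [0, y], [h, g],
[y, h] ∪ [g, 1] with y ≤ c₁ and g ≤ c₂ whose two upper pools have means at least c₁ and c₂. Every
state above c₁ then gets a₁ or a₂, and every state above c₂ gets a₂. So if Receiver obeys on path
and believes the lowest state of any other message, no state gains by deviating. Once null
recommendations are dropped, each candidate is an equilibrium (`IsObedient.isEquilibrium`,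
`nestedSets_isObedient`).

Upper bounds come from linear programming duality. A convex function above u has, under any
mean-preserving contraction, an expectation no larger than under the prior, so its prior expectation
bounds the commitment payoff (`integral_u_le_of_priceBound`). Functions with at most two kinks
suffice. If a candidate attains such a bound, every Sender-preferred equilibrium has a commitment
outcome (`senderPreferred_of_priceBound`).

`nestedCommitment_or_binding` shows that the bound is attained unless g ≤ c₂ gets in the way. The
delicate case is the one in which the commitment optimum pools an upper interval [y, 1] into two
sets with means c₁ and c₂, priced by the line through (c₁, v₁) and (c₂, v₂). The middle interval [h,
g] of mean c₁ is widened until the outer set has mean c₂. If g reaches c₂ too early, y is raised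
instead; both means then bind, and the first mean constraint has the higher price.

In that case the bound must use equilibrium and not only Bayes plausibility. Almost surely Sender
gets 0, v₁ or v₂ (`IsEquilibrium.ae_payoff`), and states above c₂ get v₂
(`IsEquilibrium.ae_reveal`). Add to the payoff the slack of both mean constraints at the multipliers
of `IsBindingNested.exists_prices`. State by state, the recommended action is then the unique
maximizer among the actions that equilibrium allows (`ae_pricedPayoff_le`). Integration bounds R.
Equality forces the same action in almost every state and zero slack, hence atoms exactly at c₁ and
c₂ (`IsEquilibrium.payoff_le_of_binding`). -/

/-- `P` and `T` behave like the mass `μ [0, x]` and the partial first moment `∫_{[0, x]} t dμ` of an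
atomless probability `μ` with support `[0, 1]`. -/
structure IsCumulative (P T : ℝ → ℝ) : Prop where
  mass_continuous : Continuous P
  moment_continuous : Continuous T
  mass_zero : P 0 = 0
  moment_zero : T 0 = 0
  mass_one : P 1 = 1
  mass_lt : ∀ {a b : ℝ}, 0 ≤ a → a < b → b ≤ 1 → P a < P b
  lower : ∀ {a b : ℝ}, 0 ≤ a → a < b → b ≤ 1 → a * (P b - P a) < T b - T a
  upper : ∀ {a b : ℝ}, 0 ≤ a → a < b → b ≤ 1 → T b - T a < b * (P b - P a)

/-! ### The prior through its mass and first moment. -/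

namespace Environment

variable {n : ℕ} (E : Environment n)

/-- The prior as a measure on the real line. -/
def realPrior : Measure ℝ := E.prior.map Subtype.val

/-- The prior probability of `[0, x]`. -/
def mass (x : ℝ) : ℝ := ∫ _ in (0 : ℝ)..x, (1 : ℝ) ∂E.realPrior

/-- The first moment of the prior on `[0, x]`. -/
def moment (x : ℝ) : ℝ := ∫ t in (0 : ℝ)..x, t ∂E.realPrior

instance : IsProbabilityMeasure E.realPrior :=
  Measure.isProbabilityMeasure_map measurable_subtype_coe.aemeasurable

instance : NullSingletonClass E.prior := by
  unfold prior
  infer_instance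

theorem realPrior_apply {S : Set ℝ} (hS : MeasurableSet S) :
    E.realPrior S = E.prior (states S) :=
  Measure.map_apply measurable_subtype_coe hS

theorem measurableSet_states {S : Set ℝ} (hS : MeasurableSet S) : MeasurableSet (states S) :=
  measurable_subtype_coe hS

instance : NullSingletonClass E.realPrior where
  measure_singleton x := by
    rw [realPrior_apply E (measurableSet_singleton x)]
    refine Set.Subsingleton.measure_zero (fun a ha b hb => ?_) _
    exact Subtype.ext ((show (a : ℝ) = x from ha).trans (show (b : ℝ) = x from hb).symm)

theorem realPrior_compl : E.realPrior (Icc 0 1)ᶜ = 0 := by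
  rw [realPrior_apply E measurableSet_Icc.compl]
  convert measure_empty (μ := E.prior)
  ext ω
  simp [states]

theorem ae_mem_Icc : ∀ᵐ t ∂E.realPrior, t ∈ Icc (0 : ℝ) 1 := by
  rw [ae_iff]
  exact E.realPrior_compl

/-- Positivity of the density enters here; it is the source of every strict inequality for `mass`
and `moment`. -/
theorem realPrior_Ioo_pos {a b : ℝ} (ha : 0 ≤ a) (hab : a < b) (hb : b ≤ 1) :
    0 < E.realPrior (Ioo a b) := by
  rw [realPrior_apply E measurableSet_Ioo, pos_iff_ne_zero]
  intro h0
  have hm : Measurable fun ω => ENNReal.ofReal (E.f ω) := E.f_measurable.ennreal_ofReal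
  rw [prior, withDensity_apply_eq_zero hm] at h0
  have hS : {ω | ENNReal.ofReal (E.f ω) ≠ 0} ∩ states (Ioo a b) = states (Ioo a b) := by
    ext ω
    simp [E.f_pos ω]
  rw [hS, unitInterval.volume_apply] at h0
  have hI : Subtype.val '' (states (Ioo a b)) = Ioo a b := by
    ext t
    constructor
    · rintro ⟨ω, hω, rfl⟩
      exact hω
    · intro ht
      exact ⟨⟨t, by linarith [ht.1], by linarith [ht.2]⟩, ht, rfl⟩
  rw [hI, Real.volume_Ioo, ENNReal.ofReal_eq_zero] at h0
  linarith

theorem integrable_id_realPrior : Integrable (fun t : ℝ => t) E.realPrior := by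
  refine Integrable.of_bound (C := 1) measurable_id.aestronglyMeasurable ?_
  filter_upwards [E.ae_mem_Icc] with t ht
  rw [Real.norm_eq_abs, abs_le]
  constructor <;> linarith [ht.1, ht.2]

theorem mass_sub {a b : ℝ} (hab : a ≤ b) :
    E.mass b - E.mass a = E.realPrior.real (Icc a b) := by
  unfold mass
  rw [intervalIntegral.integral_interval_sub_left
    (integrable_const _).intervalIntegrable (integrable_const _).intervalIntegrable,
    intervalIntegral.integral_of_le hab, integral_Icc_eq_integral_Ioc.symm]
  simp

theorem moment_sub {a b : ℝ} (hab : a ≤ b) :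
    E.moment b - E.moment a = ∫ t in Icc a b, t ∂E.realPrior := by
  unfold moment
  rw [intervalIntegral.integral_interval_sub_left
    E.integrable_id_realPrior.intervalIntegrable E.integrable_id_realPrior.intervalIntegrable,
    intervalIntegral.integral_of_le hab, integral_Icc_eq_integral_Ioc.symm]

theorem setIntegral_pos_of_Ioo {a b : ℝ} (ha : 0 ≤ a) (hab : a < b) (hb : b ≤ 1) {F : ℝ → ℝ}
    (hF : Integrable F E.realPrior) (hpos : ∀ t ∈ Ioo a b, 0 < F t) :
    0 < ∫ t in Icc a b, F t ∂E.realPrior := by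
  rw [integral_Icc_eq_integral_Ioo, setIntegral_pos_iff_support_of_nonneg_ae]
  · refine (E.realPrior_Ioo_pos ha hab hb).trans_le (measure_mono fun t ht => ⟨?_, ht⟩)
    exact (hpos t ht).ne'
  · filter_upwards [ae_restrict_mem measurableSet_Ioo] with t ht using (hpos t ht).le
  · exact hF.integrableOn

theorem isCumulative : IsCumulative E.mass E.moment where
  mass_continuous := intervalIntegral.continuous_primitive
    (fun _ _ => (integrable_const _).intervalIntegrable) 0
  moment_continuous := intervalIntegral.continuous_primitive
    (fun _ _ => E.integrable_id_realPrior.intervalIntegrable) 0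
  mass_zero := by simp [mass]
  moment_zero := by simp [moment]
  mass_one := by
    have h := E.mass_sub zero_le_one
    have h1 : E.realPrior.real (Icc 0 1) = 1 := by
      rw [measureReal_def, (prob_compl_eq_zero_iff measurableSet_Icc).1 E.realPrior_compl,
        ENNReal.toReal_one]
    have h0 : E.mass 0 = 0 := by simp [mass]
    linarith
  mass_lt := by
    intro a b ha hab hb
    have h := E.mass_sub hab.le
    have := E.setIntegral_pos_of_Ioo ha hab hb (integrable_const (1 : ℝ)) (by simp)
    simp only [integral_const, MeasurableSet.univ, measureReal_restrict_apply, univ_inter,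
      smul_eq_mul, mul_one] at this
    linarith
  lower := by
    intro a b ha hab hb
    have := E.setIntegral_pos_of_Ioo ha hab hb
      (E.integrable_id_realPrior.sub (integrable_const a)) (fun t ht => by simpa using ht.1)
    rw [E.mass_sub hab.le, E.moment_sub hab.le]
    simp only [Pi.sub_apply] at this
    rw [integral_sub E.integrable_id_realPrior.integrableOn (integrable_const a)] at this
    simp only [integral_const, MeasurableSet.univ, measureReal_restrict_apply, univ_inter,
      smul_eq_mul] at this
    linarith
  upper := by
    intro a b ha hab hb
    have := E.setIntegral_pos_of_Ioo ha hab hb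
      ((integrable_const b).sub E.integrable_id_realPrior) (fun t ht => by simpa using ht.2)
    rw [E.mass_sub hab.le, E.moment_sub hab.le]
    simp only [Pi.sub_apply] at this
    rw [integral_sub (integrable_const b) E.integrable_id_realPrior.integrableOn] at this
    simp only [integral_const, MeasurableSet.univ, measureReal_restrict_apply, univ_inter,
      smul_eq_mul] at this
    linarith

end Environment

/-! ### Nested recommendations and dual bounds. -/

/-- The recommendations `[0, y]`, `[h, g]`, `[y, h] ∪ [g, 1]` respect the cutoffs `c₁ ≤ c₂`, and
their conditional means are at least `c₁` on `[h, g]` and at least `c₂` on `[y, h] ∪ [g, 1]`. -/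
structure IsNested (P T : ℝ → ℝ) (c₁ c₂ y h g : ℝ) : Prop where
  nonneg : 0 ≤ y
  y_le : y ≤ h
  h_le : h ≤ g
  g_le : g ≤ c₂
  y_le_cutoff : y ≤ c₁
  middle : c₁ * (P g - P h) ≤ T g - T h
  outer : c₂ * (P h - P y + 1 - P g) ≤ T h - T y + T 1 - T g

/-- Sender's payoff from the recommendations `[0, y]`, `[h, g]`, `[y, h] ∪ [g, 1]`. -/
def nestedValue (P : ℝ → ℝ) (v₁ v₂ y h g : ℝ) : ℝ :=
  v₁ * (P g - P h) + v₂ * (P h - P y + 1 - P g)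

/-- The value `R` is, up to any `ε > 0`, at least the prior expectation of a convex function above
Sender's value function, of the form `x ↦ α + β x + c (b - x)⁺ + d (a - x)⁺`. -/
def IsPriceBound (P T : ℝ → ℝ) (c₁ c₂ v₁ v₂ R : ℝ) : Prop :=
  ∀ ε > 0, ∃ α β c d b a : ℝ, 0 ≤ c ∧ 0 ≤ d ∧ b ∈ Icc (0 : ℝ) 1 ∧ a ∈ Icc (0 : ℝ) 1 ∧
    (∀ x ∈ Icc (0 : ℝ) 1,
      0 ≤ α + β * x + c * max (b - x) 0 + d * max (a - x) 0 ∧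
      (c₁ ≤ x → v₁ ≤ α + β * x + c * max (b - x) 0 + d * max (a - x) 0) ∧
      (c₂ ≤ x → v₂ ≤ α + β * x + c * max (b - x) 0 + d * max (a - x) 0)) ∧
    α + β * T 1 + c * (b * P b - T b) + d * (a * P a - T a) ≤ R + ε

/-- Put-call parity. Calls are natural for the dual functions, puts for integrated distribution
functions. -/
theorem max_sub_zero_eq (b x : ℝ) : max (b - x) 0 = max (x - b) 0 - (x - b) := by
  rcases le_total b x with h | h
  · rw [max_eq_right (by linarith), max_eq_left (by linarith)]; ring
  · rw [max_eq_left (by linarith), max_eq_right (by linarith)]; ring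

/-- A price bound in terms of call payoffs `k + c (x - b)⁺ + d (x - a)⁺`. -/
theorem IsPriceBound.of_calls {P T : ℝ → ℝ} {c₁ c₂ v₁ v₂ R : ℝ}
    (H : ∀ ε > 0, ∃ k c d b a : ℝ, 0 ≤ c ∧ 0 ≤ d ∧ b ∈ Icc (0 : ℝ) 1 ∧ a ∈ Icc (0 : ℝ) 1 ∧ 0 ≤ k ∧
      (∀ x ∈ Icc (0 : ℝ) 1,
        (c₁ ≤ x → v₁ ≤ k + c * max (x - b) 0 + d * max (x - a) 0) ∧
        (c₂ ≤ x → v₂ ≤ k + c * max (x - b) 0 + d * max (x - a) 0)) ∧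
      k + c * (T 1 - T b - b * (1 - P b)) + d * (T 1 - T a - a * (1 - P a)) ≤ R + ε) :
    IsPriceBound P T c₁ c₂ v₁ v₂ R := by
  intro ε hε
  obtain ⟨k, c, d, b, a, hc, hd, hb, ha, hk, hx, hR⟩ := H ε hε
  refine ⟨k - c * b - d * a, c + d, c, d, b, a, hc, hd, hb, ha, fun x hx01 => ?_, ?_⟩
  · have e : k - c * b - d * a + (c + d) * x + c * max (b - x) 0 + d * max (a - x) 0 =
        k + c * max (x - b) 0 + d * max (x - a) 0 := by
      rw [max_sub_zero_eq b x, max_sub_zero_eq a x]; ring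
    rw [e]
    exact ⟨by positivity, hx x hx01⟩
  · linarith

namespace IsCumulative

variable {P T : ℝ → ℝ} (H : IsCumulative P T)
include H

theorem mass_le {a b : ℝ} (ha : 0 ≤ a) (hab : a ≤ b) (hb : b ≤ 1) : P a ≤ P b := by
  rcases hab.eq_or_lt with rfl | h
  · exact le_rfl
  · exact (H.mass_lt ha h hb).le

/-- The function T - c P falls to the left of c and rises to its right. It takes equal values at a <
b exactly when [a, b] has conditional mean c, so intervals of given mean can be found by the
intermediate value theorem. -/
theorem excess_anti {a b c : ℝ} (ha : 0 ≤ a) (hab : a < b) (hbc : b ≤ c) (hb : b ≤ 1) :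
    T b - c * P b < T a - c * P a := by
  have h1 := H.upper ha hab hb
  have h2 := H.mass_lt ha hab hb
  nlinarith

theorem excess_mono {a b c : ℝ} (ha : 0 ≤ a) (hab : a < b) (hca : c ≤ a) (hb : b ≤ 1) :
    T a - c * P a < T b - c * P b := by
  have h1 := H.lower ha hab hb
  have h2 := H.mass_lt ha hab hb
  nlinarith

theorem excess_anti_le {a b c : ℝ} (ha : 0 ≤ a) (hab : a ≤ b) (hbc : b ≤ c) (hb : b ≤ 1) :
    T b - c * P b ≤ T a - c * P a := by
  rcases hab.eq_or_lt with rfl | h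
  · exact le_rfl
  · exact (H.excess_anti ha h hbc hb).le

theorem excess_mono_le {a b c : ℝ} (ha : 0 ≤ a) (hab : a ≤ b) (hca : c ≤ a) (hb : b ≤ 1) :
    T a - c * P a ≤ T b - c * P b := by
  rcases hab.eq_or_lt with rfl | h
  · exact le_rfl
  · exact (H.excess_mono ha h hca hb).le

theorem excess_continuous (c : ℝ) : Continuous fun x => T x - c * P x :=
  H.moment_continuous.sub (continuous_const.mul H.mass_continuous)

/-- An upper interval with conditional mean `c`. -/
theorem exists_upper {c z : ℝ} (hc : 0 ≤ c) (hz : z ≤ 1) (hcz : c ≤ z)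
    (h : T z < c * P z) : ∃ a, 0 < a ∧ a ≤ c ∧ T z - c * P z = T a - c * P a ∧ (c < z → a < c) := by
  have h0 : (0 : ℝ) ≤ c := hc
  have hiv := intermediate_value_Icc' h0 (H.excess_continuous c).continuousOn
  have hm : T z - c * P z ∈ Icc (T c - c * P c) (T 0 - c * P 0) := by
    refine ⟨H.excess_mono_le hc hcz le_rfl hz, ?_⟩
    rw [H.mass_zero, H.moment_zero]
    linarith
  obtain ⟨a, ⟨ha0, hac⟩, hav⟩ := hiv hm
  simp only at hav
  refine ⟨a, ?_, hac, hav.symm, fun hlt => ?_⟩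
  · rcases ha0.eq_or_lt with rfl | h'
    · rw [H.mass_zero, H.moment_zero] at hav
      linarith
    · exact h'
  · rcases hac.eq_or_lt with rfl | h'
    · linarith [H.excess_mono hc hlt le_rfl hz]
    · exact h'

/-- Along the curve of intervals `[h, g]` with conditional mean `c₁`, the excess of
`[y, h] ∪ [g, 1]` over `c₂` takes intermediate values. -/
theorem exists_on_curve {c₁ c₂ y hs he gs ge : ℝ} (hy : 0 ≤ y) (hys : y ≤ hs) (hs1 : hs ≤ c₁)
    (hye : y ≤ he) (he1 : he ≤ c₁) (hgs : c₁ ≤ gs) (hg : gs ≤ ge) (hge : ge ≤ 1)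
    (es : T hs - c₁ * P hs = T gs - c₁ * P gs) (ee : T he - c₁ * P he = T ge - c₁ * P ge)
    (ls : T hs - c₂ * P hs - (T gs - c₂ * P gs) ≤ T y - c₂ * P y - (T 1 - c₂ * P 1))
    (le : T y - c₂ * P y - (T 1 - c₂ * P 1) ≤ T he - c₂ * P he - (T ge - c₂ * P ge)) :
    ∃ h g, y ≤ h ∧ h ≤ c₁ ∧ gs ≤ g ∧ g ≤ ge ∧ T h - c₁ * P h = T g - c₁ * P g ∧
      T h - c₂ * P h - (T g - c₂ * P g) = T y - c₂ * P y - (T 1 - c₂ * P 1) := by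
  set C := T y - c₂ * P y - (T 1 - c₂ * P 1) with hC
  let D : Set (ℝ × ℝ) := {q | T q.1 - c₁ * P q.1 = T q.2 - c₁ * P q.2}
  have hP := H.mass_continuous
  have hT := H.moment_continuous
  have hD : IsClosed D := isClosed_eq (by fun_prop) (by fun_prop)
  let K : Set (ℝ × ℝ) := Icc y c₁ ×ˢ Icc gs ge
  have hK : IsCompact K := isCompact_Icc.prod isCompact_Icc
  let L : ℝ × ℝ → ℝ := fun q => T q.1 - c₂ * P q.1 - (T q.2 - c₂ * P q.2)
  have hL : Continuous L := by fun_prop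
  let A : Set ℝ := Prod.snd '' (K ∩ (D ∩ {q | L q ≤ C}))
  let B : Set ℝ := Prod.snd '' (K ∩ (D ∩ {q | C ≤ L q}))
  have hA : IsClosed A := ((hK.inter_right
    (hD.inter (isClosed_le hL continuous_const))).image continuous_snd).isClosed
  have hB : IsClosed B := ((hK.inter_right
    (hD.inter (isClosed_le continuous_const hL))).image continuous_snd).isClosed
  -- Each right end g is the end of some interval of mean c₁, so the two closed sets of right ends
  -- cover. This avoids proving that h depends continuously on g.
  have hcov : Icc gs ge ⊆ A ∪ B := by
    intro g hgI
    have hiv := intermediate_value_Icc' (hye.trans he1) (H.excess_continuous c₁).continuousOn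
    have hm : T g - c₁ * P g ∈ Icc (T c₁ - c₁ * P c₁) (T y - c₁ * P y) := by
      constructor
      · exact H.excess_mono_le (hy.trans (hye.trans he1)) (hgs.trans hgI.1) le_rfl
          (hgI.2.trans hge)
      · have h1 := H.excess_mono_le (c := c₁) (by linarith [hgI.1]) hgI.2
          (hgs.trans hgI.1) hge
        have h2 := H.excess_anti_le hy hye he1 (by linarith)
        linarith
    obtain ⟨h, hh, hhe⟩ := hiv hm
    rcases le_total (L (h, g)) C with hl | hl
    · exact Or.inl ⟨(h, g), ⟨⟨hh, hgI⟩, hhe, hl⟩, rfl⟩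
    · exact Or.inr ⟨(h, g), ⟨⟨hh, hgI⟩, hhe, hl⟩, rfl⟩
  have hAne : (Icc gs ge ∩ A).Nonempty :=
    ⟨gs, ⟨le_rfl, hg⟩, (hs, gs), ⟨⟨⟨hys, hs1⟩, le_rfl, hg⟩, es, ls⟩, rfl⟩
  have hBne : (Icc gs ge ∩ B).Nonempty :=
    ⟨ge, ⟨hg, le_rfl⟩, (he, ge), ⟨⟨⟨hye, he1⟩, hg, le_rfl⟩, ee, le⟩, rfl⟩
  obtain ⟨g, hgI, ⟨⟨h, _⟩, ⟨⟨hh, -⟩, hd, hl⟩, rfl⟩, ⟨⟨h', _⟩, ⟨⟨hh', -⟩, hd', hl'⟩, rfl⟩⟩ :=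
    isPreconnected_closed_iff.1 isPreconnected_Icc A B hA hB hcov hAne hBne
  simp only [D, L, mem_ofPred_eq] at hd hl hd' hl' hh hh' hgI
  -- Connectedness gives a common g with two left ends, one on each side of C. Strict monotonicity
  -- of T - c₁ P below c₁ identifies them.
  have hhh : h = h' := by
    rcases lt_trichotomy h h' with hlt | heq | hlt
    · have := H.excess_anti (hy.trans hh.1) hlt hh'.2 (by linarith [hh'.2])
      linarith
    · exact heq
    · have := H.excess_anti (hy.trans hh'.1) hlt hh.2 (by linarith [hh.2])
      linarith
  subst hhh
  exact ⟨h, _, hh.1, hh.2, hgI.1, hgI.2, hd, le_antisymm hl hl'⟩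

/-- Steep calls near `1` are cheap. -/
theorem exists_steep_call {v ε : ℝ} (hv : 0 < v) (hε : 0 < ε) :
    ∃ δ, 0 < δ ∧ δ ≤ 1 ∧
      v / δ * (T 1 - T (1 - δ) - (1 - δ) * (1 - P (1 - δ))) ≤ ε := by
  -- The cost of the call is at most v times the mass of [1 - δ, 1], which vanishes because P is
  -- continuous.
  have hc : Filter.Tendsto (fun δ => v * (1 - P (1 - δ))) (nhds 0) (nhds 0) := by
    have hP := H.mass_continuous
    have : Continuous fun δ => v * (1 - P (1 - δ)) := by fun_prop
    simpa [H.mass_one] using this.tendsto 0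
  obtain ⟨r, hr, hr'⟩ := Metric.eventually_nhds_iff.1 (hc.eventually (gt_mem_nhds hε))
  refine ⟨min (r / 2) 1, by positivity, min_le_right _ _, ?_⟩
  set δ := min (r / 2) 1 with hδ
  have h0 : 0 < δ := by positivity
  have h1 : δ ≤ 1 := min_le_right _ _
  have h2 : v * (1 - P (1 - δ)) < ε := hr' (by
    rw [Real.dist_eq, sub_zero, abs_of_pos h0]
    linarith [min_le_left (r / 2) 1])
  have h3 := (H.upper (a := 1 - δ) (b := 1) (by linarith) (by linarith) le_rfl)
  rw [H.mass_one] at h3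
  have h4 : T 1 - T (1 - δ) - (1 - δ) * (1 - P (1 - δ)) ≤ δ * (1 - P (1 - δ)) := by linarith
  calc _ ≤ v / δ * (δ * (1 - P (1 - δ))) := by gcongr
    _ = v * (1 - P (1 - δ)) := by field_simp
    _ ≤ ε := h2.le

end IsCumulative

/-! ### Attaining the dual bound, or ending in the binding case. -/

/-- Some nested recommendation attains an upper bound on Sender's commitment payoff. -/
def NestedCommitment (P T : ℝ → ℝ) (c₁ c₂ v₁ v₂ : ℝ) : Prop :=
  ∃ y h g, IsNested P T c₁ c₂ y h g ∧ IsPriceBound P T c₁ c₂ v₁ v₂ (nestedValue P v₁ v₂ y h g)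

/-- The means of `[h, c₂]` and `[y, h] ∪ [c₂, 1]` are `c₁` and `c₂`, and the price of relaxing the
first constraint exceeds that of relaxing the second. -/
structure IsBindingNested (P T : ℝ → ℝ) (c₁ c₂ v₁ v₂ y h : ℝ) : Prop where
  nonneg : 0 ≤ y
  y_lt : y < h
  h_lt : h < c₁
  cutoff_lt : c₁ < c₂
  cutoff_lt_one : c₂ < 1
  middle : T c₂ - T h = c₁ * (P c₂ - P h)
  outer : T h - T y + T 1 - T c₂ = c₂ * (P h - P y + 1 - P c₂)
  price : c₁ * v₂ - c₂ * v₁ < y * (v₂ - v₁)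

/-- Only a₀ and a₂ are used. The dual function is the call with kink b through (c₂, v₂); `hC` says
that it passes above (c₁, v₁). -/
theorem nestedCommitment_of_top_only {P T : ℝ → ℝ} {c₁ c₂ v₁ v₂ b : ℝ} (hc : c₂ < 1)
    (hv1 : 0 < v₁) (hv : v₁ < v₂) (hb0 : 0 < b) (hb : b < c₂) (hbe : T 1 - T b = c₂ * (1 - P b))
    (hC : v₁ * (c₂ - b) ≤ v₂ * (c₁ - b)) : NestedCommitment P T c₁ c₂ v₁ v₂ := by
  have hv2 : 0 < v₂ := hv1.trans hv
  have hd : 0 < c₂ - b := by linarith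
  have hb1 : b ≤ c₁ := by
    have : 0 ≤ v₂ * (c₁ - b) := le_trans (by positivity) hC
    nlinarith
  refine ⟨b, b, b, ⟨hb0.le, le_rfl, le_rfl, hb.le, hb1, by simp, by linarith⟩,
    .of_calls fun ε hε => ?_⟩
  refine ⟨0, v₂ / (c₂ - b), 0, b, 0, by positivity, le_rfl, ⟨hb0.le, by linarith⟩, by simp,
    le_rfl, fun x hx => ⟨fun h => ?_, fun h => ?_⟩, ?_⟩
  · calc v₁ ≤ v₂ / (c₂ - b) * (c₁ - b) := by
          rw [div_mul_eq_mul_div, le_div_iff₀ hd]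
          exact hC
      _ ≤ v₂ / (c₂ - b) * max (x - b) 0 := by
          gcongr
          exact le_max_of_le_left (by linarith)
      _ = _ := by ring
  · calc v₂ = v₂ / (c₂ - b) * (c₂ - b) := by field_simp
      _ ≤ v₂ / (c₂ - b) * max (x - b) 0 := by
          gcongr
          exact le_max_of_le_left (by linarith)
      _ = _ := by ring
  · have e : v₂ / (c₂ - b) * (T 1 - T b - b * (1 - P b)) = v₂ * (1 - P b) := by
      rw [show T 1 - T b - b * (1 - P b) = (c₂ - b) * (1 - P b) by linarith]
      field_simp
    simp only [nestedValue]
    linarith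

/-- Three consecutive intervals cut at a and b, with means c₁ and c₂ on the upper two. The dual
function leaves 0 at a, passes through (c₁, v₁), steepens at b and passes through (c₂, v₂). -/
theorem nestedCommitment_of_cutoffs {P T : ℝ → ℝ} {c₁ c₂ v₁ v₂ a b : ℝ} (hc : c₂ < 1)
    (hv1 : 0 < v₁) (hb1 : c₁ < b) (hb : b < c₂)
    (hbe : T 1 - T b = c₂ * (1 - P b)) (ha0 : 0 < a) (ha : a < c₁)
    (hae : T b - c₁ * P b = T a - c₁ * P a) (hC : a * (v₂ - v₁) ≤ c₁ * v₂ - c₂ * v₁) :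
    NestedCommitment P T c₁ c₂ v₁ v₂ := by
  have hd : 0 < c₂ - b := by linarith
  have hda : 0 < c₁ - a := by linarith
  set l := v₁ / (c₁ - a) with hl
  have hl0 : 0 < l := by positivity
  have hlv : l * (c₁ - a) = v₁ := by rw [hl]; field_simp
  -- The first segment, extended to c₂, stays below v₂. Hence the change of slope at b is
  -- nonnegative, which is convexity.
  have hle : l * (c₂ - c₁) ≤ v₂ - v₁ := by
    rw [hl, div_mul_eq_mul_div, div_le_iff₀ hda]
    linarith
  set m := (v₂ - v₁ - l * (c₂ - c₁)) / (c₂ - b) with hm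
  have hm0 : 0 ≤ m := div_nonneg (by linarith) hd.le
  have hmv : m * (c₂ - b) = v₂ - v₁ - l * (c₂ - c₁) := by rw [hm]; field_simp
  refine ⟨a, a, b, ⟨ha0.le, le_rfl, by linarith, hb.le, ha.le, by linarith, by linarith⟩,
    .of_calls fun ε hε => ?_⟩
  refine ⟨0, l, m, a, b, hl0.le, hm0, ⟨ha0.le, by linarith⟩, ⟨by linarith, by linarith⟩,
    le_rfl, fun x hx => ⟨fun h => ?_, fun h => ?_⟩, ?_⟩
  · have h1 : l * (c₁ - a) ≤ l * max (x - a) 0 := by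
      gcongr
      exact le_max_of_le_left (by linarith)
    have h2 : 0 ≤ m * max (x - b) 0 := by positivity
    linarith
  · have h1 : l * (c₂ - a) ≤ l * max (x - a) 0 := by
      gcongr
      exact le_max_of_le_left (by linarith)
    have h2 : m * (c₂ - b) ≤ m * max (x - b) 0 := by
      gcongr
      exact le_max_of_le_left (by linarith)
    linarith
  · simp only [nestedValue]
    rw [show T 1 - T a - a * (1 - P a) = (c₂ - a) * (1 - P b) + (c₁ - a) * (P b - P a) by linarith,
      show T 1 - T b - b * (1 - P b) = (c₂ - b) * (1 - P b) by linarith,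
      mul_add, ← mul_assoc, ← mul_assoc, ← mul_assoc, hlv, hmv]
    have : l * (c₂ - a) = v₁ + l * (c₂ - c₁) := by linarith
    rw [this]
    linarith

namespace IsCumulative

variable {P T : ℝ → ℝ} (H : IsCumulative P T)
include H

theorem nestedCommitment_of_mean_ge {c₁ c₂ v₁ v₂ : ℝ} (h1 : 0 ≤ c₁) (h12 : c₁ ≤ c₂)
    (hv1 : 0 < v₁) (hv : v₁ < v₂) (hm : c₂ ≤ T 1) : NestedCommitment P T c₁ c₂ v₁ v₂ := by
  refine ⟨0, 0, 0, ⟨le_rfl, le_rfl, le_rfl, h1.trans h12, h1, ?_, ?_⟩, .of_calls fun ε hε => ?_⟩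
  · simp
  · simp [H.mass_zero, H.moment_zero, hm]
  · refine ⟨v₂, 0, 0, 0, 0, le_rfl, le_rfl, by simp, by simp, by linarith, fun x _ => ?_, ?_⟩
    · constructor <;> intro <;> linarith
    · simp [nestedValue, H.mass_zero, hε.le]

/-- Mean 1 is out of reach for a set of positive mass, so a₂ earns nothing. The dual function must
still reach v₂ at 1, which a steep call does at cost ε; this is why `IsPriceBound` allows an error.
What remains is the problem with a₀ and a₁ only. -/
theorem nestedCommitment_of_cutoff_eq_one {c₁ v₁ v₂ : ℝ} (h1 : 0 ≤ c₁) (h12 : c₁ ≤ 1)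
    (hv1 : 0 < v₁) (hv : v₁ < v₂) : NestedCommitment P T c₁ 1 v₁ v₂ := by
  have hv2 : 0 < v₂ := hv1.trans hv
  have top : ∀ {δ : ℝ}, 0 < δ → ∀ x : ℝ, 1 ≤ x → v₂ ≤ v₂ / δ * max (x - (1 - δ)) 0 := by
    intro δ hδ x hx
    calc v₂ = v₂ / δ * δ := by field_simp
      _ ≤ _ := by
        gcongr
        exact le_max_of_le_left (by linarith)
  have nn : ∀ {δ : ℝ}, 0 < δ → ∀ x : ℝ, 0 ≤ v₂ / δ * max (x - (1 - δ)) 0 := by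
    intro δ hδ x
    positivity
  rcases le_or_gt c₁ (T 1) with hm | hm
  · refine ⟨0, 0, 1, ⟨le_rfl, le_rfl, zero_le_one, le_rfl, h1, ?_, ?_⟩, .of_calls fun ε hε => ?_⟩
    · simp [H.mass_zero, H.moment_zero, H.mass_one, hm]
    · simp [H.mass_one]
    · obtain ⟨δ, h0, hδ1, hδ⟩ := H.exists_steep_call hv2 hε
      refine ⟨v₁, v₂ / δ, 0, 1 - δ, 0, by positivity, le_rfl, ⟨by linarith, by linarith⟩, by simp,
        hv1.le, fun x hx => ⟨fun _ => ?_, fun h => ?_⟩, ?_⟩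
      · linarith [nn h0 x]
      · linarith [top h0 x h]
      · simp only [nestedValue, H.mass_zero, H.mass_one]
        linarith
  rcases h12.eq_or_lt with rfl | h12
  · refine ⟨1, 1, 1, ⟨zero_le_one, le_rfl, le_rfl, le_rfl, le_rfl, ?_, ?_⟩,
      .of_calls fun ε hε => ?_⟩
    · simp
    · simp [H.mass_one]
    · obtain ⟨δ, h0, hδ1, hδ⟩ := H.exists_steep_call hv2 hε
      refine ⟨0, v₂ / δ, 0, 1 - δ, 0, by positivity, le_rfl, ⟨by linarith, by linarith⟩, by simp,
        le_rfl, fun x hx => ⟨fun h => ?_, fun h => ?_⟩, ?_⟩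
      · linarith [top h0 x h]
      · linarith [top h0 x h]
      · simp only [nestedValue, H.mass_one]
        linarith
  · obtain ⟨a, ha0, ha1, ha, halt⟩ := H.exists_upper h1 le_rfl h12.le (by rwa [H.mass_one, mul_one])
    have hac := halt h12
    rw [H.mass_one] at ha
    refine ⟨a, a, 1, ⟨ha0.le, le_rfl, by linarith, le_rfl, ha1, ?_, ?_⟩, .of_calls fun ε hε => ?_⟩
    · rw [H.mass_one]
      linarith
    · simp [H.mass_one]
    · obtain ⟨δ, h0, hδ1, hδ⟩ := H.exists_steep_call hv2 hε
      have hd : 0 < c₁ - a := by linarith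
      refine ⟨0, v₂ / δ, v₁ / (c₁ - a), 1 - δ, a, by positivity, by positivity,
        ⟨by linarith, by linarith⟩, ⟨ha0.le, by linarith⟩,
        le_rfl, fun x hx => ⟨fun h => ?_, fun h => ?_⟩, ?_⟩
      · have : v₁ ≤ v₁ / (c₁ - a) * max (x - a) 0 := by
          calc v₁ = v₁ / (c₁ - a) * (c₁ - a) := by field_simp
            _ ≤ _ := by
              gcongr
              exact le_max_of_le_left (by linarith)
        linarith [nn h0 x]
      · have : 0 ≤ v₁ / (c₁ - a) * max (x - a) 0 := by positivity
        linarith [top h0 x h]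
      · have e : v₁ / (c₁ - a) * (T 1 - T a - a * (1 - P a)) = v₁ * (1 - P a) := by
          rw [show T 1 - T a - a * (1 - P a) = (c₁ - a) * (1 - P a) by linarith]
          field_simp
        simp only [nestedValue, H.mass_one]
        linarith

/-- The top interval `[b, 1]` pooled at mean `c₂`. -/
theorem exists_top {c₂ : ℝ} (hc0 : 0 ≤ c₂) (hc : c₂ < 1) (hm : T 1 < c₂) :
    ∃ b, 0 < b ∧ b < c₂ ∧ T 1 - T b = c₂ * (1 - P b) := by
  obtain ⟨b, h0, h1, h2, h3⟩ := H.exists_upper hc0 le_rfl hc.le (by rwa [H.mass_one, mul_one])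
  rw [H.mass_one] at h2
  exact ⟨b, h0, h3 hc, by linarith⟩

/-- Even [0, b] has mean at least c₁, so a₀ is not needed. The dual function is v₁ plus a call with
kink b through (c₂, v₂). -/
theorem nestedCommitment_of_lower_mean_ge {c₁ c₂ v₁ v₂ b : ℝ} (h1 : 0 ≤ c₁) (hc : c₂ < 1)
    (hv1 : 0 < v₁) (hv : v₁ < v₂) (hb0 : 0 < b) (hb : b < c₂) (hbe : T 1 - T b = c₂ * (1 - P b))
    (hC : c₁ * P b ≤ T b) : NestedCommitment P T c₁ c₂ v₁ v₂ := by
  have hd : 0 < c₂ - b := by linarith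
  have hvv : 0 ≤ v₂ - v₁ := by linarith
  refine ⟨0, 0, b, ⟨le_rfl, le_rfl, hb0.le, hb.le, h1, ?_, ?_⟩, .of_calls fun ε hε => ?_⟩
  · simpa [H.mass_zero, H.moment_zero] using hC
  · simp only [H.mass_zero, H.moment_zero]
    linarith
  refine ⟨v₁, (v₂ - v₁) / (c₂ - b), 0, b, 0, by positivity, le_rfl, ⟨hb0.le, by linarith⟩, by simp,
    hv1.le, fun x hx => ⟨fun h => ?_, fun h => ?_⟩, ?_⟩
  · have : 0 ≤ (v₂ - v₁) / (c₂ - b) * max (x - b) 0 := by positivity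
    linarith
  · have : v₂ - v₁ ≤ (v₂ - v₁) / (c₂ - b) * max (x - b) 0 := by
      calc v₂ - v₁ = (v₂ - v₁) / (c₂ - b) * (c₂ - b) := by field_simp
        _ ≤ _ := by
          gcongr
          exact le_max_of_le_left (by linarith)
    linarith
  · have e : (v₂ - v₁) / (c₂ - b) * (T 1 - T b - b * (1 - P b)) = (v₂ - v₁) * (1 - P b) := by
      rw [show T 1 - T b - b * (1 - P b) = (c₂ - b) * (1 - P b) by linarith]
      field_simp
    simp only [nestedValue, H.mass_zero]
    linarith

/-- Two pools with means `c₁` and `c₂` whose union is the upper interval `[y, 1]` that is optimal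
at equal prices. -/
theorem nestedCommitment_of_pools {c₁ c₂ v₁ v₂ y h g : ℝ} (hc : c₁ < c₂)
    (hv : v₁ < v₂) (hy1 : y ≤ 1)
    (hy : y = max ((c₁ * v₂ - c₂ * v₁) / (v₂ - v₁)) 0)
    (hN : IsNested P T c₁ c₂ y h g) (e₁ : T g - T h = c₁ * (P g - P h))
    (e₂ : T h - T y + T 1 - T g = c₂ * (P h - P y + 1 - P g)) :
    NestedCommitment P T c₁ c₂ v₁ v₂ := by
  have hvv : 0 < v₂ - v₁ := by linarith
  have hd : 0 < c₂ - c₁ := by linarith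
  set l := (v₂ - v₁) / (c₂ - c₁) with hl
  have hl0 : 0 < l := by positivity
  have hlv : l * (c₂ - c₁) = v₂ - v₁ := by rw [hl]; field_simp
  -- The zero of the line through (c₁, v₁) and (c₂, v₂); l is its slope.
  set z := (c₁ * v₂ - c₂ * v₁) / (v₂ - v₁) with hz
  have hlz : l * (c₁ - z) = v₁ := by
    rw [hl, hz]
    field_simp
    ring
  refine ⟨y, h, g, hN, .of_calls fun ε hε => ?_⟩
  have hzy : z ≤ y := by rw [hy]; exact le_max_left _ _
  have hy0 : 0 ≤ y := by rw [hy]; exact le_max_right _ _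
  refine ⟨l * (y - z), l, 0, y, 0, hl0.le, le_rfl, ⟨hy0, hy1⟩, by simp,
    mul_nonneg hl0.le (by linarith), fun x hx => ⟨fun h => ?_, fun h => ?_⟩, ?_⟩
  · have h1 : l * (x - y) ≤ l * max (x - y) 0 := by
      gcongr
      exact le_max_left _ _
    nlinarith
  · have h1 : l * (x - y) ≤ l * max (x - y) 0 := by
      gcongr
      exact le_max_left _ _
    nlinarith
  -- Complementary slackness: either y = z and the constant vanishes, or y = 0 and no mass lies
  -- below the kink.
  · have hcase : l * (y - z) * P y = 0 := by
      rcases le_total z 0 with h' | h'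
      · rw [hy, max_eq_right h', H.mass_zero, mul_zero]
      · rw [hy, max_eq_left h', sub_self, mul_zero, zero_mul]
    have e3 : T 1 - T y = c₁ * (P g - P h) + c₂ * (P h - P y + 1 - P g) := by linarith
    simp only [nestedValue]
    rw [e3]
    have hl2 : l * (c₂ - z) = v₂ := by linarith
    refine le_of_eq_of_le (b := v₁ * (P g - P h) + v₂ * (P h - P y + 1 - P g)) ?_ (by linarith)
    linear_combination hcase + (P g - P h) * hlz + (P h - P y + 1 - P g) * hl2

/-- The start (a, hs, gs) satisfies both mean constraints with equality, but a lies above the zero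
of the equal-price line. Lowering the bottom to y = max(zero, 0) pushes the outer mean down;
widening [h, g] along the curve of mean c₁ restores it, unless g would have to pass c₂. -/
theorem nestedCommitment_or_binding_of_start {c₁ c₂ v₁ v₂ a b hs gs : ℝ} (h1 : 0 ≤ c₁)
    (hc12 : c₁ < c₂) (hc : c₂ < 1) (hv : v₁ < v₂)
    (hbe : T 1 - T b = c₂ * (1 - P b)) (ha : 0 < a) (has : a ≤ hs) (hs1 : hs ≤ c₁)
    (hgs : c₁ ≤ gs) (hgs2 : gs ≤ c₂) (hbg : b ≤ gs) (hb0 : 0 < b)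
    (es : T hs - c₁ * P hs = T gs - c₁ * P gs)
    (ls : T hs - c₂ * P hs - (T gs - c₂ * P gs) = T a - c₂ * P a - (T 1 - c₂ * P 1))
    (hC : c₁ * v₂ - c₂ * v₁ < a * (v₂ - v₁)) :
    NestedCommitment P T c₁ c₂ v₁ v₂ ∨ ∃ y h, IsBindingNested P T c₁ c₂ v₁ v₂ y h := by
  have hvv : 0 < v₂ - v₁ := by linarith
  set y := max ((c₁ * v₂ - c₂ * v₁) / (v₂ - v₁)) 0 with hy
  have hya : y < a := max_lt (by rwa [div_lt_iff₀ hvv]) ha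
  have hy0 : 0 ≤ y := le_max_right _ _
  have pools : ∀ {he ge}, y ≤ he → he ≤ c₁ → gs ≤ ge → ge ≤ c₂ →
      T he - c₁ * P he = T ge - c₁ * P ge →
      T y - c₂ * P y - (T 1 - c₂ * P 1) ≤ T he - c₂ * P he - (T ge - c₂ * P ge) →
      NestedCommitment P T c₁ c₂ v₁ v₂ := by
    intro he ge hye he1 hge hge2 ee le
    have hls : T hs - c₂ * P hs - (T gs - c₂ * P gs) ≤ T y - c₂ * P y - (T 1 - c₂ * P 1) := by
      have := H.excess_anti_le hy0 hya.le (by linarith : a ≤ c₂) (by linarith)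
      linarith
    obtain ⟨h, g, hyh, hh1, hg1, hg2, e1, e2⟩ := H.exists_on_curve hy0 (hya.le.trans has) hs1
      hye he1 hgs hge (by linarith) es ee hls le
    rw [H.mass_one] at e2
    refine H.nestedCommitment_of_pools (y := y) (h := h) (g := g) hc12 hv (by linarith) rfl
      ⟨hy0, hyh, by linarith, by linarith, by linarith, by linarith, by linarith⟩
      (by linarith) (by linarith)
  rcases le_or_gt (T y - c₁ * P y) (T c₂ - c₁ * P c₂) with hcase | hcase
  -- The middle interval can be widened down to h = y before g passes c₂. The outer set is then [g,
  -- 1], whose mean is at least c₂ since g ≥ b.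
  · have hm : T y - c₁ * P y ∈ Icc (T gs - c₁ * P gs) (T c₂ - c₁ * P c₂) := by
      refine ⟨?_, hcase⟩
      have := H.excess_anti_le hy0 (hya.le.trans has) hs1 (by linarith)
      linarith
    obtain ⟨g, hgI, hg⟩ := intermediate_value_Icc hgs2 (H.excess_continuous c₁).continuousOn hm
    simp only at hg
    refine Or.inl (pools le_rfl (by linarith) hgI.1 hgI.2 hg.symm ?_)
    have := H.excess_anti_le (c := c₂) hb0.le (hbg.trans hgI.1) hgI.2 (by linarith [hgI.2])
    rw [H.mass_one]
    linarith
  · have hm : T c₂ - c₁ * P c₂ ∈ Icc (T c₁ - c₁ * P c₁) (T y - c₁ * P y) :=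
      ⟨H.excess_mono_le h1 hc12.le le_rfl hc.le, hcase.le⟩
    obtain ⟨h, hhI, hh⟩ := intermediate_value_Icc' (by linarith : y ≤ c₁)
      (H.excess_continuous c₁).continuousOn hm
    simp only at hh
    rcases le_or_gt (T y - c₂ * P y - (T 1 - c₂ * P 1)) (T h - c₂ * P h - (T c₂ - c₂ * P c₂))
      with hl | hl
    · exact Or.inl (pools hhI.1 hhI.2 hgs2 le_rfl hh hl)
    right
    have hhc : h < c₁ := by
      rcases hhI.2.eq_or_lt with rfl | h'
      · linarith [H.excess_mono h1 hc12 le_rfl hc.le]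
      · exact h'
    have htop : T c₂ - c₂ * P c₂ < T 1 - c₂ * P 1 := H.excess_mono (h1.trans hc12.le) hc le_rfl le_rfl
    -- At g = c₂ the outer mean is still below c₂. Removing low states by raising y to z makes it
    -- exact, and z > y gives the strict price inequality.
    have hm2 : T h - c₂ * P h - (T c₂ - c₂ * P c₂) + (T 1 - c₂ * P 1) ∈
        Icc (T h - c₂ * P h) (T y - c₂ * P y) := ⟨by linarith, by linarith⟩
    obtain ⟨z, hzI, hz⟩ := intermediate_value_Icc' hhI.1 (H.excess_continuous c₂).continuousOn hm2
    simp only at hz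
    have hyz : y < z := by
      rcases hzI.1.eq_or_lt with rfl | h'
      · linarith
      · exact h'
    have hzh : z < h := by
      rcases hzI.2.eq_or_lt with rfl | h'
      · linarith
      · exact h'
    rw [H.mass_one] at hz
    refine ⟨z, h, by linarith, hzh, hhc, hc12, hc, by linarith, by linarith, ?_⟩
    have : (c₁ * v₂ - c₂ * v₁) / (v₂ - v₁) < z := (le_max_left _ _).trans_lt hyz
    rwa [div_lt_iff₀ hvv] at this

theorem nestedCommitment_or_binding {c₁ c₂ v₁ v₂ : ℝ} (h1 : 0 ≤ c₁) (h12 : c₁ ≤ c₂) (h2 : c₂ ≤ 1)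
    (hv1 : 0 < v₁) (hv : v₁ < v₂) :
    NestedCommitment P T c₁ c₂ v₁ v₂ ∨ ∃ y h, IsBindingNested P T c₁ c₂ v₁ v₂ y h := by
  rcases le_or_gt c₂ (T 1) with hm | hm
  · exact Or.inl (H.nestedCommitment_of_mean_ge h1 h12 hv1 hv hm)
  rcases h2.eq_or_lt with rfl | hc
  · exact Or.inl (H.nestedCommitment_of_cutoff_eq_one h1 h12 hv1 hv)
  obtain ⟨b, hb0, hb, hbe⟩ := H.exists_top (h1.trans h12) hc hm
  rcases le_or_gt (v₁ * (c₂ - b)) (v₂ * (c₁ - b)) with hC | hC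
  · exact Or.inl (nestedCommitment_of_top_only hc hv1 hv hb0 hb hbe hC)
  have hc12 : c₁ < c₂ := by
    rcases h12.eq_or_lt with rfl | h'
    · nlinarith
    · exact h'
  rcases le_or_gt (c₁ * P b) (T b) with hA | hA
  · exact Or.inl (H.nestedCommitment_of_lower_mean_ge h1 hc hv1 hv hb0 hb hbe hA)
  rcases lt_or_ge c₁ b with hbc | hbc
  · obtain ⟨a, ha0, ha1, hae, halt⟩ := H.exists_upper h1 (by linarith : b ≤ 1) hbc.le hA
    rcases le_or_gt (a * (v₂ - v₁)) (c₁ * v₂ - c₂ * v₁) with hY | hY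
    · exact Or.inl (nestedCommitment_of_cutoffs hc hv1 hbc hb hbe ha0 (halt hbc) hae hY)
    · refine H.nestedCommitment_or_binding_of_start h1 hc12 hc hv hbe ha0 le_rfl ha1 hbc.le
        hb.le le_rfl hb0 hae.symm ?_ hY
      rw [H.mass_one]
      linarith
  -- When b ≤ c₁ the curve starts at the degenerate interval [c₁, c₁], with outer set [b, 1].
  · refine H.nestedCommitment_or_binding_of_start h1 hc12 hc hv hbe hb0 hbc le_rfl le_rfl
      hc12.le hbc hb0 rfl ?_ (by linarith)
    rw [H.mass_one]
    linarith

end IsCumulative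

-- Mean-preserving contractions and weak duality.

attribute [instance] Assessment.markov_σ Assessment.markov_τ Assessment.markov_p

theorem integrable_of_mem_Icc {G : Measure ℝ} [IsFiniteMeasure G] (hG : G (Icc 0 1)ᶜ = 0)
    {F : ℝ → ℝ} (hF : Continuous F) : Integrable F G := by
  obtain ⟨C, hC⟩ := isCompact_Icc.exists_bound_of_continuousOn (s := Icc (0 : ℝ) 1) hF.continuousOn
  refine Integrable.of_bound (C := C) hF.aestronglyMeasurable ?_
  have : ∀ᵐ t ∂G, t ∈ Icc (0 : ℝ) 1 := by
    rw [ae_iff]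
    exact hG
  filter_upwards [this] with t ht using hC t ht

/-- The integrated distribution function is the expected put payoff. -/
theorem integral_cdf_eq {G : Measure ℝ} [IsProbabilityMeasure G] (hG : G (Icc 0 1)ᶜ = 0) {x : ℝ}
    (hx : 0 ≤ x) : ∫ s in (0 : ℝ)..x, cdf G s = ∫ t, max (x - t) 0 ∂G := by
  have hae : ∀ᵐ t ∂G, t ∈ Icc (0 : ℝ) 1 := by
    rw [ae_iff]
    exact hG
  have h1 : ∀ s, cdf G s = ∫ t, (if t ≤ s then (1 : ℝ) else 0) ∂G := by
    intro s
    rw [cdf_eq_real, ← integral_indicator_one measurableSet_Iic]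
    rfl
  rw [intervalIntegral.integral_of_le hx]
  -- Fubini: for t in [0, 1], the length of {s ∈ (0, x] : t ≤ s} is the put payoff max (x - t) 0.
  simp_rw [h1]
  rw [integral_integral_swap]
  · refine integral_congr_ae ?_
    filter_upwards [hae] with t ht
    have h2 : (fun s : ℝ => if t ≤ s then (1 : ℝ) else 0) = (Ici t).indicator 1 := by
      ext s
      simp [indicator_apply]
    rw [h2, integral_indicator_one measurableSet_Ici, measureReal_restrict_apply measurableSet_Ici]
    have h3 : volume.real (Ici t ∩ Ioc 0 x) = volume.real (Ioi t ∩ Ioc 0 x) :=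
      measureReal_congr (Filter.EventuallyEq.inter Ioi_ae_eq_Ici.symm (ae_eq_refl _))
    rw [h3, inter_comm, Ioc_inter_Ioi, Real.volume_real_Ioc, max_eq_right ht.1]
  · refine Integrable.of_bound (C := 1) ?_ ?_
    · refine Measurable.aestronglyMeasurable ?_
      exact Measurable.ite (measurableSet_le measurable_snd measurable_fst)
        measurable_const measurable_const
    · refine Filter.Eventually.of_forall fun q => ?_
      simp only [Function.uncurry]
      split_ifs <;> simp

theorem integral_put_one {G : Measure ℝ} [IsProbabilityMeasure G] (hG : G (Icc 0 1)ᶜ = 0) :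
    ∫ t, max (1 - t) 0 ∂G = 1 - ∫ t, t ∂G := by
  have h2 : ∫ t, max (1 - t) 0 ∂G = ∫ t, (1 - t) ∂G := by
    refine integral_congr_ae ?_
    have hae : ∀ᵐ t ∂G, t ∈ Icc (0 : ℝ) 1 := by
      rw [ae_iff]
      exact hG
    filter_upwards [hae] with t ht
    exact max_eq_left (by linarith [ht.2])
  rw [h2, integral_sub (integrable_const 1) (integrable_of_mem_Icc hG continuous_id')]
  simp

namespace Environment

theorem integral_put_realPrior {n : ℕ} (E : Environment n) {b : ℝ} (hb : b ∈ Icc (0 : ℝ) 1) :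
    ∫ t, max (b - t) 0 ∂E.realPrior = b * E.mass b - E.moment b := by
  have h1 := E.mass_sub hb.1
  have h2 := E.moment_sub hb.1
  rw [E.isCumulative.mass_zero, sub_zero] at h1
  rw [E.isCumulative.moment_zero, sub_zero] at h2
  have h3 : ∫ t, max (b - t) 0 ∂E.realPrior = ∫ t in Icc 0 b, (b - t) ∂E.realPrior := by
    rw [← integral_indicator measurableSet_Icc]
    refine integral_congr_ae ?_
    filter_upwards [E.ae_mem_Icc] with t ht
    by_cases htb : t ≤ b
    · rw [indicator_of_mem (show t ∈ Icc 0 b from ⟨ht.1, htb⟩), max_eq_left (by linarith)]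
    · rw [indicator_of_notMem (fun h => htb h.2), max_eq_right (by linarith)]
  rw [h3, integral_sub (integrable_const b) E.integrable_id_realPrior.integrableOn, h1, h2]
  simp [mul_comm]

theorem integral_id_realPrior {n : ℕ} (E : Environment n) :
    ∫ t, t ∂E.realPrior = E.moment 1 := by
  have h := E.moment_sub zero_le_one
  rw [E.isCumulative.moment_zero, sub_zero] at h
  rw [h, Measure.restrict_eq_self_of_ae_mem E.ae_mem_Icc]

theorem IsMPC.put_le {n : ℕ} {E : Environment n} {G : Measure ℝ} (hG : E.IsMPC G) {b : ℝ}
    (hb : b ∈ Icc (0 : ℝ) 1) : ∫ t, max (b - t) 0 ∂G ≤ b * E.mass b - E.moment b := by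
  have := hG.prob
  have h := hG.le b hb
  rw [integral_cdf_eq hG.supp hb.1] at h
  refine h.trans_eq ?_
  change ∫ s in (0 : ℝ)..b, cdf E.realPrior s = _
  rw [integral_cdf_eq E.realPrior_compl hb.1, E.integral_put_realPrior hb]

theorem IsMPC.integral_id {n : ℕ} {E : Environment n} {G : Measure ℝ} (hG : E.IsMPC G) :
    ∫ t, t ∂G = E.moment 1 := by
  have := hG.prob
  have h := hG.eq
  change _ = ∫ s in (0 : ℝ)..1, cdf E.realPrior s at h
  rw [integral_cdf_eq hG.supp zero_le_one, integral_cdf_eq E.realPrior_compl zero_le_one,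
    integral_put_one hG.supp, integral_put_one E.realPrior_compl, E.integral_id_realPrior] at h
  linarith

/-- Mean-preserving contractions are characterized by put payoffs. -/
theorem isMPC_of_put {n : ℕ} {E : Environment n} {G : Measure ℝ} [IsProbabilityMeasure G]
    (hG : G (Icc 0 1)ᶜ = 0)
    (hle : ∀ b ∈ Icc (0 : ℝ) 1, ∫ t, max (b - t) 0 ∂G ≤ ∫ t, max (b - t) 0 ∂E.realPrior)
    (heq : ∫ t, t ∂G = ∫ t, t ∂E.realPrior) : E.IsMPC G where
  prob := inferInstance
  supp := hG
  le x hx := by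
    change _ ≤ ∫ s in (0 : ℝ)..x, cdf E.realPrior s
    rw [integral_cdf_eq hG hx.1, integral_cdf_eq E.realPrior_compl hx.1]
    exact hle x hx
  eq := by
    change _ = ∫ s in (0 : ℝ)..1, cdf E.realPrior s
    rw [integral_cdf_eq hG zero_le_one, integral_cdf_eq E.realPrior_compl zero_le_one]
    rw [integral_put_one hG, integral_put_one E.realPrior_compl, heq]

theorem cutoff_one_nonneg (E : Environment 3) : 0 ≤ E.γ 1 := by
  rw [← E.γ_zero]
  exact E.γ_mono (by decide)

theorem cutoff_one_le_two (E : Environment 3) : E.γ 1 ≤ E.γ 2 := E.γ_mono (by decide)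

theorem cutoff_two_le_one (E : Environment 3) : E.γ 2 ≤ 1 := by
  rw [← E.γ_last]
  exact E.γ_mono (by decide)

theorem payoff_one_pos (E : Environment 3) : 0 < E.v 1 := by
  rw [← E.v_zero 0 rfl]
  exact E.v_strictMono (by decide)

theorem payoff_one_lt_two (E : Environment 3) : E.v 1 < E.v 2 := E.v_strictMono (by decide)

theorem mem_A_zero (E : Environment 3) {x : ℝ} : x ∈ E.A 0 ↔ 0 ≤ x ∧ x ≤ E.γ 1 := by
  have h : E.A 0 = Icc (E.γ 0) (E.γ 1) := rfl
  rw [h, E.γ_zero, mem_Icc]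

theorem mem_A_one (E : Environment 3) {x : ℝ} : x ∈ E.A 1 ↔ E.γ 1 ≤ x ∧ x ≤ E.γ 2 := Iff.rfl

theorem mem_A_two (E : Environment 3) {x : ℝ} : x ∈ E.A 2 ↔ E.γ 2 ≤ x ∧ x ≤ 1 := by
  have h : E.A 2 = Icc (E.γ 2) (E.γ (Fin.last 3)) := rfl
  rw [h, E.γ_last, mem_Icc]

theorem le_u {n : ℕ} (E : Environment n) {x : ℝ} {i : Fin n} (h : x ∈ E.A i) : E.v i ≤ E.u x :=
  le_csSup ((Set.toFinite _).image _).bddAbove ⟨i, h, rfl⟩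

theorem u_eq (E : Environment 3) {x : ℝ} (hx : x ∈ Icc (0 : ℝ) 1) :
    E.u x = if E.γ 2 ≤ x then E.v 2 else if E.γ 1 ≤ x then E.v 1 else 0 := by
  have hv1 := E.payoff_one_pos
  have hv2 := E.payoff_one_lt_two
  have h12 := E.cutoff_one_le_two
  have hv0 : E.v 0 = 0 := E.v_zero 0 rfl
  have upper : ∀ (c : ℝ) (i : Fin 3), x ∈ E.A i → (∀ j, x ∈ E.A j → E.v j ≤ c) → E.u x ≤ c := by
    intro c i hi hc
    refine csSup_le ⟨_, i, hi, rfl⟩ ?_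
    rintro _ ⟨j, hj, rfl⟩
    exact hc j hj
  split_ifs with h2 h1
  · have hA : x ∈ E.A 2 := E.mem_A_two.2 ⟨h2, hx.2⟩
    refine le_antisymm (upper _ 2 hA fun j _ => ?_) (E.le_u hA)
    exact E.v_strictMono.monotone (Fin.le_last j)
  · have hA : x ∈ E.A 1 := E.mem_A_one.2 ⟨h1, by linarith⟩
    refine le_antisymm (upper _ 1 hA fun j hj => ?_) (E.le_u hA)
    fin_cases j
    · simp only [Fin.zero_eta]
      linarith
    · simp
    · exact absurd (E.mem_A_two.1 hj).1 h2
  · have hA : x ∈ E.A 0 := E.mem_A_zero.2 ⟨hx.1, by linarith⟩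
    refine le_antisymm (upper _ 0 hA fun j hj => ?_) (hv0 ▸ E.le_u hA)
    fin_cases j
    · simp [hv0]
    · exact absurd (E.mem_A_one.1 hj).1 h1
    · exact absurd (E.mem_A_two.1 hj).1 h2

/-- A price bound limits Sender's commitment payoff. -/
theorem integral_u_le_of_priceBound (E : Environment 3) {R : ℝ}
    (hR : IsPriceBound E.mass E.moment (E.γ 1) (E.γ 2) (E.v 1) (E.v 2) R) {G : Measure ℝ}
    (hG : E.IsMPC G) : ∫ x, E.u x ∂G ≤ R := by
  refine le_of_forall_pos_le_add fun ε hε => ?_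
  obtain ⟨α, β, c, d, b, a, hc, hd, hb, ha, hφ, hle⟩ := hR ε hε
  have := hG.prob
  have hae : ∀ᵐ t ∂G, t ∈ Icc (0 : ℝ) 1 := by
    rw [ae_iff]
    exact hG.supp
  have i1 : Integrable (fun t : ℝ => t) G := integrable_of_mem_Icc hG.supp continuous_id
  have i2 : Integrable (fun t : ℝ => max (b - t) 0) G :=
    integrable_of_mem_Icc hG.supp (by fun_prop)
  have i3 : Integrable (fun t : ℝ => max (a - t) 0) G :=
    integrable_of_mem_Icc hG.supp (by fun_prop)
  have i4 : Integrable (fun t : ℝ => α + β * t) G := (integrable_const α).add (i1.const_mul β)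
  have i5 : Integrable (fun t : ℝ => α + β * t + c * max (b - t) 0) G := i4.add (i2.const_mul c)
  have hint : ∫ t, (α + β * t + c * max (b - t) 0 + d * max (a - t) 0) ∂G =
      α + β * ∫ t, t ∂G + c * ∫ t, max (b - t) 0 ∂G + d * ∫ t, max (a - t) 0 ∂G := by
    rw [integral_add i5 (i3.const_mul d), integral_add i4 (i2.const_mul c),
      integral_add (integrable_const α) (i1.const_mul β)]
    rw [integral_const_mul, integral_const_mul, integral_const_mul]
    simp
  have hpos := E.payoff_one_pos
  have hlt := E.payoff_one_lt_two
  calc ∫ x, E.u x ∂G ≤ ∫ t, (α + β * t + c * max (b - t) 0 + d * max (a - t) 0) ∂G := by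
        refine integral_mono_of_nonneg ?_ (i5.add (i3.const_mul d)) ?_
        · filter_upwards [hae] with t ht
          rw [E.u_eq ht]
          simp only [Pi.zero_apply]
          split_ifs <;> linarith
        · filter_upwards [hae] with t ht
          rw [E.u_eq ht]
          obtain ⟨h0, h1, h2⟩ := hφ t ht
          split_ifs with h h'
          · exact h2 h
          · exact h1 h'
          · exact h0
    _ ≤ R + ε := by
        rw [hint, hG.integral_id]
        have := mul_le_mul_of_nonneg_left (hG.put_le hb) hc
        have := mul_le_mul_of_nonneg_left (hG.put_le ha) hd
        linarith

end Environment

/-! ### Equilibrium outcomes as feasible commitment outcomes. -/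

namespace Environment

theorem posteriorMean_mem {n : ℕ} (e : Assessment n) (m : Message) :
    posteriorMean e m ∈ Icc (0 : ℝ) 1 := by
  have hi : Integrable (fun ω : State => (ω : ℝ)) (e.p m) :=
    Integrable.of_bound (C := 1) measurable_subtype_coe.aestronglyMeasurable
      (Filter.Eventually.of_forall fun ω => by
        rw [Real.norm_eq_abs, abs_of_nonneg ω.2.1]
        exact ω.2.2)
  constructor
  · exact integral_nonneg fun ω => ω.2.1
  · calc posteriorMean e m ≤ ∫ _ : State, (1 : ℝ) ∂(e.p m) :=
          integral_mono hi (integrable_const 1) fun ω => ω.2.2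
      _ = 1 := by simp

theorem measurable_posteriorMean {n : ℕ} (e : Assessment n) : Measurable (posteriorMean e) := by
  have h : StronglyMeasurable (Function.uncurry fun (_ : Message) (ω : State) => (ω : ℝ)) :=
    (measurable_subtype_coe.comp measurable_snd).stronglyMeasurable
  exact (h.integral_kernel_prod_right (κ := e.p)).measurable

theorem integrable_state {α : Type*} [MeasurableSpace α] {μ : Measure α} [IsFiniteMeasure μ]
    {F : ℝ → ℝ} (hF : Continuous F) {s : α → State} (hs : Measurable s) :
    Integrable (fun x => F (s x)) μ := by
  obtain ⟨C, hC⟩ := isCompact_Icc.exists_bound_of_continuousOn (s := Icc (0 : ℝ) 1) hF.continuousOn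
  exact Integrable.of_bound (C := C)
    (hF.measurable.comp (measurable_subtype_coe.comp hs)).aestronglyMeasurable
    (Filter.Eventually.of_forall fun x => hC _ (s x).2)

variable {n : ℕ} (E : Environment n)

theorem payoff_eq_sum (e : Assessment n) (m : Message) :
    E.payoff e m = ∑ i, (e.τ m).real {i} * E.v i := by
  unfold payoff
  rw [integral_fintype Integrable.of_finite]
  simp

theorem measurable_payoff (e : Assessment n) : Measurable (E.payoff e) := by
  have : E.payoff e = fun m => ∑ i, (e.τ m).real {i} * E.v i := funext (E.payoff_eq_sum e)
  rw [this]
  refine Finset.measurable_fun_sum _ fun i _ => Measurable.mul_const ?_ _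
  exact (e.τ.measurable_coe (measurableSet_singleton i)).ennreal_toReal

theorem sum_action (e : Assessment n) (m : Message) : ∑ i, (e.τ m).real {i} = 1 := by
  simp

theorem payoff_le_of_forall (e : Assessment n) {m : Message} {c : ℝ}
    (h : ∀ i, 0 < e.τ m {i} → E.v i ≤ c) : E.payoff e m ≤ c := by
  rw [payoff_eq_sum, ← one_mul c, ← sum_action e m, Finset.sum_mul]
  refine Finset.sum_le_sum fun i _ => ?_
  rcases eq_or_ne (e.τ m {i}) 0 with h0 | h0
  · simp [measureReal_def, h0]
  · exact mul_le_mul_of_nonneg_left (h i (pos_iff_ne_zero.2 h0)) measureReal_nonneg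

theorem le_payoff_of_forall (e : Assessment n) {m : Message} {c : ℝ}
    (h : ∀ i, 0 < e.τ m {i} → c ≤ E.v i) : c ≤ E.payoff e m := by
  rw [payoff_eq_sum, ← one_mul c, ← sum_action e m, Finset.sum_mul]
  refine Finset.sum_le_sum fun i _ => ?_
  rcases eq_or_ne (e.τ m {i}) 0 with h0 | h0
  · simp [measureReal_def, h0]
  · exact mul_le_mul_of_nonneg_left (h i (pos_iff_ne_zero.2 h0)) measureReal_nonneg

/-- The distribution of messages. -/
abbrev messageLaw (e : Assessment n) : Measure Message := e.σ ∘ₘ E.prior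

theorem integrable_payoff (e : Assessment n) (μ : Measure Message) [IsFiniteMeasure μ] :
    Integrable (E.payoff e) μ := by
  refine Integrable.of_bound (C := ∑ i, |E.v i|) (E.measurable_payoff e).aestronglyMeasurable
    (Filter.Eventually.of_forall fun m => ?_)
  have hb : ∀ i, |E.v i| ≤ ∑ j, |E.v j| := fun i =>
    Finset.single_le_sum (f := fun j => |E.v j|) (fun j _ => abs_nonneg _) (Finset.mem_univ i)
  rw [Real.norm_eq_abs, abs_le]
  constructor
  · exact E.le_payoff_of_forall e fun i _ => (abs_le.1 (hb i)).1
  · exact E.payoff_le_of_forall e fun i _ => (abs_le.1 (hb i)).2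

variable {E}

theorem IsEquilibrium.payoff_le_u {e : Assessment n} (h : E.IsEquilibrium e) (m : Message) :
    E.payoff e m ≤ E.u (posteriorMean e m) :=
  E.payoff_le_of_forall e fun i hi => E.le_u (h.receiver m i hi)

/-- Expectations under the joint law of states and messages can be computed from beliefs. -/
theorem IsEquilibrium.integral_joint {e : Assessment n} (h : E.IsEquilibrium e)
    {F : Message → State → ℝ} (hF : Measurable (Function.uncurry F))
    (hi : Integrable (Function.uncurry F) (E.messageLaw e ⊗ₘ e.p)) :
    ∫ q, F q.2 q.1 ∂(E.prior ⊗ₘ e.σ) = ∫ m, ∫ ω, F m ω ∂(e.p m) ∂(E.messageLaw e) := by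
  have h1 := Measure.integral_compProd hi
  rw [← h.bayes, integral_map measurable_swap.aemeasurable hF.aestronglyMeasurable] at h1
  exact h1

theorem integral_state_joint (e : Assessment n) {F : State → ℝ} (hF : Measurable F) :
    ∫ q, F q.1 ∂(E.prior ⊗ₘ e.σ) = ∫ ω, F ω ∂E.prior := by
  conv_rhs => rw [← Measure.fst_compProd E.prior e.σ]
  rw [Measure.fst, integral_map measurable_fst.aemeasurable hF.aestronglyMeasurable]

theorem integral_message_joint (e : Assessment n) {F : Message → ℝ} (hF : Measurable F) :
    ∫ q, F q.2 ∂(E.prior ⊗ₘ e.σ) = ∫ m, F m ∂(E.messageLaw e) := by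
  conv_rhs => rw [messageLaw, ← Measure.snd_compProd E.prior e.σ]
  rw [Measure.snd, integral_map measurable_snd.aemeasurable hF.aestronglyMeasurable]

/-- Conditional on a set of messages, posterior means average to the mean of the state. -/
theorem IsEquilibrium.integral_indicator_mean {e : Assessment n} (h : E.IsEquilibrium e)
    {S : Set Message} (hS : MeasurableSet S) (c : ℝ) :
    ∫ q, S.indicator (fun _ => (q.1 : ℝ) - c) q.2 ∂(E.prior ⊗ₘ e.σ) =
      ∫ m, S.indicator (fun m => posteriorMean e m - c) m ∂(E.messageLaw e) := by
  have hm : Measurable (Function.uncurry fun (m : Message) (ω : State) =>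
      S.indicator (fun _ => (ω : ℝ) - c) m) := by
    have : (Function.uncurry fun (m : Message) (ω : State) =>
        S.indicator (fun _ => (ω : ℝ) - c) m) =
        (Prod.fst ⁻¹' S).indicator fun q : Message × State => (q.2 : ℝ) - c := by
      ext q
      by_cases hq : q.1 ∈ S <;> simp [Function.uncurry, hq]
    rw [this]
    exact ((measurable_subtype_coe.comp measurable_snd).sub_const c).indicator (measurable_fst hS)
  rw [h.integral_joint hm]
  · refine integral_congr_ae (Filter.Eventually.of_forall fun m => ?_)
    by_cases hmS : m ∈ S
    · simp only [indicator_of_mem hmS, posteriorMean]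
      rw [integral_sub (integrable_state (F := fun t => t) continuous_id' measurable_id')
        (integrable_const c)]
      simp
    · simp [indicator_of_notMem hmS]
  · refine Integrable.of_bound (C := 1 + |c|) hm.aestronglyMeasurable
      (Filter.Eventually.of_forall fun q => ?_)
    refine (norm_indicator_le_norm_self (s := S) (fun _ => (q.2 : ℝ) - c) q.1).trans ?_
    refine (norm_sub_le _ _).trans ?_
    rw [Real.norm_eq_abs, Real.norm_eq_abs, abs_of_nonneg q.2.2.1]
    linarith [q.2.2.2]

theorem outcome_fst_supp (e : Assessment n) : (E.outcome e).1 (Icc 0 1)ᶜ = 0 := by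
  change (Measure.map (posteriorMean e) (E.messageLaw e)) (Icc 0 1)ᶜ = 0
  rw [Measure.map_apply (measurable_posteriorMean e) measurableSet_Icc.compl]
  convert measure_empty (μ := E.messageLaw e)
  ext m
  simpa using posteriorMean_mem e m

instance (e : Assessment n) : IsProbabilityMeasure (E.outcome e).1 :=
  Measure.isProbabilityMeasure_map (measurable_posteriorMean e).aemeasurable

theorem integral_outcome (e : Assessment n) {F : ℝ → ℝ} (hF : Measurable F) :
    ∫ x, F x ∂(E.outcome e).1 = ∫ m, F (posteriorMean e m) ∂(E.messageLaw e) :=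
  integral_map (measurable_posteriorMean e).aemeasurable hF.aestronglyMeasurable

theorem integral_realPrior {F : ℝ → ℝ} (hF : Measurable F) :
    ∫ x, F x ∂E.realPrior = ∫ ω, F ω ∂E.prior :=
  integral_map measurable_subtype_coe.aemeasurable hF.aestronglyMeasurable

/-- The law of the posterior mean is a mean-preserving contraction of the prior. -/
theorem IsEquilibrium.isMPC {e : Assessment n} (h : E.IsEquilibrium e) :
    E.IsMPC (E.outcome e).1 := by
  refine isMPC_of_put (outcome_fst_supp e) (fun b _ => ?_) ?_
  · have hc : Continuous fun t : ℝ => max (b - t) 0 := by fun_prop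
    rw [integral_outcome e hc.measurable, integral_realPrior hc.measurable,
      ← integral_state_joint e (F := fun ω => max (b - (ω : ℝ)) 0)
        (hc.measurable.comp measurable_subtype_coe)]
    have hm : Measurable (Function.uncurry fun (_ : Message) (ω : State) => max (b - (ω : ℝ)) 0) :=
      hc.measurable.comp (measurable_subtype_coe.comp measurable_snd)
    have hj := h.integral_joint hm (integrable_state hc measurable_snd)
    have hmm : Measurable fun m => ∫ ω, max (b - (ω : ℝ)) 0 ∂(e.p m) :=
      (hm.stronglyMeasurable.integral_kernel_prod_right (κ := e.p)).measurable
    refine le_of_le_of_eq ?_ hj.symm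
    refine integral_mono_of_nonneg (Filter.Eventually.of_forall fun m => le_max_right _ _) ?_
      (Filter.Eventually.of_forall fun m => ?_)
    · have hi : Integrable (Function.uncurry fun (_ : Message) (ω : State) => max (b - (ω : ℝ)) 0)
          (E.messageLaw e ⊗ₘ e.p) := integrable_state hc measurable_snd
      exact Integrable.integral_compProd hi
    · refine max_le ?_ (integral_nonneg fun ω => le_max_right _ _)
      have h1 : b - posteriorMean e m = ∫ ω : State, (b - (ω : ℝ)) ∂(e.p m) := by
        rw [integral_sub (integrable_const b)
          (integrable_state (F := fun t => t) continuous_id' measurable_id')]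
        simp [posteriorMean]
      simp only
      rw [h1]
      exact integral_mono (integrable_state (F := fun t => b - t) (by fun_prop) measurable_id')
        (integrable_state hc measurable_id') fun ω => le_max_left _ _
  · rw [integral_outcome e measurable_id', integral_realPrior measurable_id']
    have := h.integral_indicator_mean MeasurableSet.univ 0
    simp only [indicator_univ, sub_zero] at this
    rw [← this, integral_state_joint e measurable_subtype_coe]

theorem IsEquilibrium.payoff_le_integral_u {E : Environment 3} {e : Assessment 3}
    (h : E.IsEquilibrium e) : (E.outcome e).2 ≤ ∫ x, E.u x ∂(E.outcome e).1 := by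
  -- A visibly measurable function that agrees with u on [0, 1], where all posterior means lie.
  let w : ℝ → ℝ := fun x => if E.γ 2 ≤ x then E.v 2 else if E.γ 1 ≤ x then E.v 1 else 0
  have hw : Measurable w := Measurable.ite measurableSet_Ici measurable_const
    (Measurable.ite measurableSet_Ici measurable_const measurable_const)
  have hae : ∀ᵐ t ∂(E.outcome e).1, t ∈ Icc (0 : ℝ) 1 := by
    rw [ae_iff]
    exact outcome_fst_supp e
  have h1 : ∫ x, E.u x ∂(E.outcome e).1 = ∫ x, w x ∂(E.outcome e).1 := by
    refine integral_congr_ae ?_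
    filter_upwards [hae] with x hx using E.u_eq hx
  rw [h1, integral_outcome e hw]
  refine integral_mono (E.integrable_payoff e _) ?_ fun m => ?_
  · refine Integrable.of_bound (C := E.v 2)
      (hw.comp (measurable_posteriorMean e)).aestronglyMeasurable
      (Filter.Eventually.of_forall fun m => ?_)
    have := E.payoff_one_pos
    have := E.payoff_one_lt_two
    simp only [w]
    rw [Real.norm_eq_abs, abs_le]
    split_ifs <;> constructor <;> linarith
  · exact (h.payoff_le_u m).trans_eq (E.u_eq (posteriorMean_mem e m))

/-- If some equilibrium attains an upper bound on Sender's commitment payoff, then every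
Sender-preferred equilibrium has a commitment outcome. -/
theorem senderPreferred_of_priceBound {E : Environment 3} {e : Assessment 3}
    (h : E.IsEquilibrium e)
    (hR : IsPriceBound E.mass E.moment (E.γ 1) (E.γ 2) (E.v 1) (E.v 2) (E.outcome e).2) :
    E.IsSenderPreferred e ∧
      ∀ e', E.IsSenderPreferred e' → E.IsCommitmentOutcome (E.outcome e') := by
  have key : ∀ e', E.IsEquilibrium e' → (E.outcome e').2 ≤ ∫ x, E.u x ∂(E.outcome e').1 ∧
      ∫ x, E.u x ∂(E.outcome e').1 ≤ (E.outcome e).2 := fun e' he' =>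
    ⟨he'.payoff_le_integral_u, E.integral_u_le_of_priceBound hR he'.isMPC⟩
  refine ⟨⟨h, fun e' he' => (key e' he').1.trans (key e' he').2⟩, fun e' he' => ?_⟩
  have h1 := key e' he'.1
  have h2 := he'.2 e h
  refine ⟨he'.1.isMPC, fun G hG => ?_, le_antisymm h1.1 (h1.2.trans h2)⟩
  exact (E.integral_u_le_of_priceBound hR hG).trans (h2.trans h1.1)

end Environment

/-! ### Obedient recommendations as equilibria. -/

/-- The lowest state in a message. -/
def lowestState (m : Message) : State := (m.isCompact.exists_isLeast m.nonempty).choose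

theorem isLeast_lowestState (m : Message) : IsLeast (m : Set State) (lowestState m) :=
  (m.isCompact.exists_isLeast m.nonempty).choose_spec

/-- The lowest state is at most c iff the message meets the closed set `Iic c`, a closed condition
in the Hausdorff topology. -/
theorem measurable_lowestState : Measurable lowestState := by
  refine measurable_of_Iic fun c => ?_
  have : lowestState ⁻¹' Iic c = {m : Message | ((m : Set State) ∩ Iic c).Nonempty} := by
    ext m
    constructor
    · intro h
      exact ⟨_, (isLeast_lowestState m).1, h⟩
    · rintro ⟨ω, hω, hc⟩
      exact ((isLeast_lowestState m).2 hω).trans hc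
  rw [this]
  exact (TopologicalSpace.NonemptyCompacts.isClosed_inter_nonempty_of_isClosed
    isClosed_Iic).measurableSet

namespace Environment

variable (E : Environment 3)

/-- Recommendations `B` that Receiver is willing to obey and that leave no state with less than the
payoff from revealing it. -/
structure IsObedient (B : Fin 3 → Set State) : Prop where
  representation : E.IsDeterministicRepresentation B
  zero_le : ∀ ω ∈ B 0, (ω : ℝ) ≤ E.γ 1
  mem_union : ∀ ω : State, E.γ 1 < ω → ω ∈ B 1 ∨ ω ∈ B 2
  mem_two : ∀ ω : State, E.γ 2 < ω → ω ∈ B 2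
  mean : ∀ i, i ≠ 0 → (B i).Nonempty → E.prior (B i) ≠ 0 ∧ E.condMean (B i) ∈ E.A i

open Classical in
/-- The highest recommendation available in a state. -/
def highest (B : Fin 3 → Set State) (ω : State) : Fin 3 :=
  if ω ∈ B 2 then 2 else if ω ∈ B 1 then 1 else 0

open Classical in
/-- The message `B i`. -/
def asMessage (B : Fin 3 → Set State) (i : Fin 3) : Message :=
  if h : IsClosed (B i) ∧ (B i).Nonempty then ⟨⟨B i, h.1.isCompact⟩, h.2⟩ else ⊤

/-- The lowest action that is optimal at `x`. -/
def lowestAction (x : ℝ) : Fin 3 := if x ≤ E.γ 1 then 0 else if x ≤ E.γ 2 then 1 else 2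

open Classical in
/-- Receiver obeys `B 1` and `B 2` and otherwise takes the lowest action at the lowest state. -/
def obey (B : Fin 3 → Set State) (m : Message) : Fin 3 :=
  if (m : Set State) = B 2 then 2 else if (m : Set State) = B 1 then 1
  else E.lowestAction (lowestState m)

open Classical in
/-- Receiver believes the messages `B i` and otherwise is sceptical. -/
def belief (B : Fin 3 → Set State) (m : Message) : Measure State :=
  if ∃ i, (m : Set State) = B i ∧ E.prior (B i) ≠ 0 then cond E.prior (m : Set State)
  else Measure.dirac (lowestState m)

theorem lowestAction_mem {x : ℝ} (hx : x ∈ Icc (0 : ℝ) 1) : x ∈ E.A (E.lowestAction x) := by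
  unfold lowestAction
  split_ifs with h1 h2
  · exact E.mem_A_zero.2 ⟨hx.1, h1⟩
  · exact E.mem_A_one.2 ⟨by linarith, h2⟩
  · exact E.mem_A_two.2 ⟨by linarith, hx.2⟩

theorem measurable_lowestAction : Measurable E.lowestAction :=
  Measurable.ite measurableSet_Iic measurable_const
    (Measurable.ite measurableSet_Iic measurable_const measurable_const)

theorem countable_messages (B : Fin 3 → Set State) :
    {m : Message | ∃ i, (m : Set State) = B i}.Countable := by
  have : {m : Message | ∃ i, (m : Set State) = B i} = ⋃ i, {m : Message | (m : Set State) = B i} := by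
    ext m
    simp
  rw [this]
  refine countable_iUnion fun i => Set.Subsingleton.countable fun m hm m' hm' => ?_
  exact SetLike.coe_injective (hm.trans hm'.symm)

/-- Off the countably many messages `B i`, the response is a measurable function of the lowest
state; countably many exceptions do not matter. -/
theorem measurable_obey (B : Fin 3 → Set State) : Measurable (E.obey B) := by
  have h : Measurable fun m => E.lowestAction (lowestState m) :=
    E.measurable_lowestAction.comp (measurable_subtype_coe.comp measurable_lowestState)
  refine h.measurable_of_countable_ne ((countable_messages B).mono fun m hm => ?_)
  by_contra hne
  refine hm ?_
  have hne' : ∀ i, (m : Set State) ≠ B i := fun i hi => hne ⟨i, hi⟩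
  simp [obey, hne']

theorem measurable_belief (B : Fin 3 → Set State) : Measurable (E.belief B) := by
  have h : Measurable fun m => Measure.dirac (lowestState m) :=
    Measure.measurable_dirac.comp measurable_lowestState
  have h2 : ∀ m : Message, (∀ i, (m : Set State) ≠ B i) → E.belief B m = Measure.dirac (lowestState m) := by
    intro m hm
    simp [belief, hm]
  refine Measure.measurable_of_measurable_coe _ fun s hs => ?_
  refine ((Measure.measurable_coe hs).comp h).measurable_of_countable_ne
    ((countable_messages B).mono fun m hm => ?_)
  by_contra hne
  refine hm ?_
  rw [h2 m fun i hi => hne ⟨i, hi⟩]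
  rfl

theorem coe_asMessage {B : Fin 3 → Set State} {i : Fin 3} (hc : IsClosed (B i))
    (hne : (B i).Nonempty) : (asMessage B i : Set State) = B i := by
  rw [asMessage, dif_pos ⟨hc, hne⟩]
  rfl

theorem measurable_highest {B : Fin 3 → Set State} (hB : ∀ i, IsClosed (B i)) :
    Measurable (highest B) := by
  classical
  exact Measurable.ite (hB 2).measurableSet measurable_const
    (Measurable.ite (hB 1).measurableSet measurable_const measurable_const)

theorem le_highest {B : Fin 3 → Set State} {ω : State} {i : Fin 3} (h : ω ∈ B i) : i ≤ highest B ω := by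
  unfold highest
  split_ifs with h2 h1
  · exact Fin.le_last i
  · fin_cases i
    · simp
    · simp
    · exact absurd h h2
  · fin_cases i
    · simp
    · exact absurd h h1
    · exact absurd h h2

theorem isProbabilityMeasure_belief (B : Fin 3 → Set State) (m : Message) : IsProbabilityMeasure (E.belief B m) := by
  unfold belief
  split_ifs with h
  · obtain ⟨i, hi, hi'⟩ := h
    exact cond_isProbabilityMeasure (hi ▸ hi')
  · infer_instance

namespace IsObedient

variable {E} {B : Fin 3 → Set State} (H : E.IsObedient B)
include H

theorem mem_highest (ω : State) : ω ∈ B (highest B ω) := by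
  unfold highest
  split_ifs with h2 h1
  · exact h2
  · exact h1
  · have : ω ∈ ⋃ i, B i := H.representation.cover ▸ mem_univ ω
    obtain ⟨i, hi⟩ := mem_iUnion.1 this
    fin_cases i
    · exact hi
    · exact absurd hi h1
    · exact absurd hi h2

/-- A set recommended twice would be its own overlap and hence null, but nonempty recommendations
other than `B 0` have positive mass. So the recommended action can be read off from the message. -/
theorem eq_of_eq {i j : Fin 3} (hne : (B i).Nonempty) (h : B i = B j) : i = j := by
  by_contra hij
  have hnull := H.representation.null i j hij
  rw [← h, inter_self] at hnull
  rcases eq_or_ne i 0 with hi | hi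
  · exact (H.mean j (fun hj => hij (hi.trans hj.symm)) (h ▸ hne)).1 (h ▸ hnull)
  · exact (H.mean i hi hne).1 hnull

theorem coe_message (ω : State) :
    (asMessage B (highest B ω) : Set State) = B (highest B ω) :=
  coe_asMessage (H.representation.closed _) ⟨ω, H.mem_highest ω⟩

theorem obey_eq {m : Message} {i : Fin 3} (h : (m : Set State) = B i) : E.obey B m = i := by
  have hne : (B i).Nonempty := h ▸ m.nonempty
  unfold obey
  split_ifs with h2 h1
  · exact (H.eq_of_eq hne (h.symm.trans h2)).symm
  · exact (H.eq_of_eq hne (h.symm.trans h1)).symm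
  · have hi : i = 0 := by
      fin_cases i
      · rfl
      · exact absurd h h1
      · exact absurd h h2
    subst hi
    have : lowestState m ∈ B 0 := h ▸ (isLeast_lowestState m).1
    simp [lowestAction, H.zero_le _ this]

/-- Sender's incentive constraint. A sceptical Receiver credits only the lowest state of m, which is
at most ω, and ω already obtains at least the action for revealing itself. -/
theorem obey_le {m : Message} {ω : State} (h : ω ∈ (m : Set State)) :
    E.obey B m ≤ highest B ω := by
  by_cases hm : ∃ i, (m : Set State) = B i
  · obtain ⟨i, hi⟩ := hm
    rw [H.obey_eq hi]
    exact le_highest (hi ▸ h)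
  · have hm' : ∀ i, (m : Set State) ≠ B i := fun i hi => hm ⟨i, hi⟩
    have hle : (lowestState m : ℝ) ≤ ω := (isLeast_lowestState m).2 h
    simp only [obey, hm', if_false, lowestAction]
    split_ifs with h1 h2
    · simp
    · rcases H.mem_union ω (by linarith) with h' | h'
      · exact le_highest h'
      · exact (by decide : (1 : Fin 3) ≤ 2).trans (le_highest h')
    · exact le_highest (H.mem_two ω (by linarith))

/-- The assessment in which Sender makes the highest recommendation. -/
def assessment : Assessment 3 where
  σ := Kernel.deterministic (fun ω => asMessage B (highest B ω))
    ((measurable_of_finite (asMessage B)).comp (measurable_highest H.representation.closed))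
  τ := Kernel.deterministic (E.obey B) (E.measurable_obey B)
  p := ⟨E.belief B, E.measurable_belief B⟩
  markov_σ := inferInstance
  markov_τ := inferInstance
  markov_p := ⟨E.isProbabilityMeasure_belief B⟩
  feasible ω := by
    rw [Kernel.deterministic_apply, ae_dirac_eq, Filter.eventually_pure, ← SetLike.mem_coe,
      H.coe_message]
    exact H.mem_highest ω

theorem payoff_assessment (m : Message) : E.payoff H.assessment m = E.v (E.obey B m) := by
  unfold payoff assessment
  simp only [Kernel.deterministic_apply]
  rw [integral_dirac]

theorem highest_fiber_ae (i : Fin 3) : highest B ⁻¹' {i} =ᵐ[E.prior] B i := by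
  have hsub : highest B ⁻¹' {i} ⊆ B i := by
    rintro ω rfl
    exact H.mem_highest ω
  refine hsub.eventuallyLE.antisymm ?_
  rw [ae_le_set]
  have : B i \ highest B ⁻¹' {i} ⊆ ⋃ j, ⋃ (_ : i ≠ j), B i ∩ B j := by
    rintro ω ⟨h, h'⟩
    exact mem_iUnion₂.2 ⟨highest B ω, fun he => h' he.symm, h, H.mem_highest ω⟩
  refine measure_mono_null this ?_
  rw [measure_iUnion_null_iff]
  intro j
  rw [measure_iUnion_null_iff]
  exact H.representation.null i j

theorem messageLaw_eq :
    E.messageLaw H.assessment = E.prior.map fun ω => asMessage B (highest B ω) := by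
  unfold messageLaw assessment
  simp only
  rw [Measure.deterministic_comp_eq_map]

theorem measurable_message : Measurable fun ω => asMessage B (highest B ω) :=
  (measurable_of_finite (asMessage B)).comp (measurable_highest H.representation.closed)

/-- On path there are at most three messages, so both sides are finite sums over the fibres of
`highest B`. Each fibre equals `B i` up to a null set, so conditioning the prior on all of `B i` is
the correct posterior; null recommendations contribute zero. -/
theorem bayes_assessment : (E.prior ⊗ₘ H.assessment.σ).map Prod.swap =
    E.messageLaw H.assessment ⊗ₘ H.assessment.p := by
  have hmsg := H.measurable_message
  have hhi := measurable_highest H.representation.closed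
  ext s hs
  rw [Measure.compProd_apply hs, messageLaw_eq, Measure.map_apply measurable_swap hs,
    Measure.compProd_apply (measurable_swap hs),
    lintegral_map (Kernel.measurable_kernel_prodMk_left hs) hmsg]
  have h1 : ∫⁻ ω, H.assessment.σ ω (Prod.mk ω ⁻¹' (Prod.swap ⁻¹' s)) ∂E.prior =
      E.prior {ω | (asMessage B (highest B ω), ω) ∈ s} := by
    have hms : MeasurableSet {ω | (asMessage B (highest B ω), ω) ∈ s} :=
      (hmsg.prodMk measurable_id) hs
    rw [← lintegral_indicator_one hms]
    refine lintegral_congr fun ω => ?_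
    change Measure.dirac (asMessage B (highest B ω)) _ = _
    rw [Measure.dirac_apply' _ (measurable_prodMk_left (measurable_swap hs))]
    rfl
  rw [h1]
  have h2 : ∫⁻ ω, H.assessment.p (asMessage B (highest B ω))
      (Prod.mk (asMessage B (highest B ω)) ⁻¹' s) ∂E.prior =
      ∑ i, E.belief B (asMessage B i) (Prod.mk (asMessage B i) ⁻¹' s) *
        E.prior (highest B ⁻¹' {i}) := by
    have := lintegral_map (μ := E.prior)
      (f := fun i => E.belief B (asMessage B i) (Prod.mk (asMessage B i) ⁻¹' s))
      (measurable_of_finite _) hhi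
    refine this.symm.trans ?_
    rw [lintegral_fintype]
    refine Finset.sum_congr rfl fun i _ => ?_
    rw [Measure.map_apply hhi (measurableSet_singleton i)]
  rw [h2]
  have h3 : E.prior {ω | (asMessage B (highest B ω), ω) ∈ s} =
      ∑ i, E.prior (highest B ⁻¹' {i} ∩ {ω | (asMessage B (highest B ω), ω) ∈ s}) := by
    have := sum_measure_preimage_singleton
      (μ := E.prior.restrict {ω | (asMessage B (highest B ω), ω) ∈ s}) (f := highest B)
      Finset.univ (fun i _ => hhi (measurableSet_singleton i))
    simp only [Finset.coe_univ, preimage_univ, Measure.restrict_apply_univ] at this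
    rw [← this]
    refine Finset.sum_congr rfl fun i _ => ?_
    rw [Measure.restrict_apply (hhi (measurableSet_singleton i))]
  rw [h3]
  refine Finset.sum_congr rfl fun i _ => ?_
  have h4 : highest B ⁻¹' {i} ∩ {ω | (asMessage B (highest B ω), ω) ∈ s} =
      highest B ⁻¹' {i} ∩ Prod.mk (asMessage B i) ⁻¹' s := by
    ext ω
    constructor
    · rintro ⟨rfl, h⟩
      exact ⟨rfl, h⟩
    · rintro ⟨rfl, h⟩
      exact ⟨rfl, h⟩
  rw [h4, measure_congr (H.highest_fiber_ae i),
    measure_congr ((H.highest_fiber_ae i).inter (ae_eq_refl (Prod.mk (asMessage B i) ⁻¹' s)))]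
  by_cases h0 : E.prior (B i) = 0
  · rw [h0, mul_zero]
    exact measure_mono_null inter_subset_left h0
  · have hne : (B i).Nonempty := nonempty_of_measure_ne_zero h0
    have hcoe := coe_asMessage (H.representation.closed i) hne
    have hbel : E.belief B (asMessage B i) = cond E.prior (B i) := by
      rw [belief, if_pos ⟨i, hcoe, h0⟩, hcoe]
    rw [hbel, cond_apply (H.representation.closed i).measurableSet, mul_comm, ← mul_assoc,
      ENNReal.mul_inv_cancel h0 (measure_ne_top _ _), one_mul]

theorem isEquilibrium : E.IsEquilibrium H.assessment where
  sender ω := by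
    change ∀ᵐ m ∂(Measure.dirac (asMessage B (highest B ω))), _
    rw [ae_dirac_eq, Filter.eventually_pure]
    intro m' hm'
    rw [H.payoff_assessment, H.payoff_assessment, H.obey_eq (H.coe_message ω)]
    exact E.v_strictMono.monotone (H.obey_le hm')
  receiver m i hi := by
    have hi' : i = E.obey B m := by
      change 0 < Measure.dirac (E.obey B m) {i} at hi
      by_contra hne
      rw [Measure.dirac_apply' _ (measurableSet_singleton i),
        indicator_of_notMem (by simpa using fun h => hne (Eq.symm h))] at hi
      exact lt_irrefl _ hi
    subst hi'
    change ∫ ω, (ω : ℝ) ∂(E.belief B m) ∈ _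
    by_cases hm : ∃ i, (m : Set State) = B i
    · obtain ⟨i, hmi⟩ := hm
      have hne : (B i).Nonempty := hmi ▸ m.nonempty
      by_cases h0 : E.prior (B i) = 0
      · rcases eq_or_ne i 0 with rfl | hi0
        · have hb : E.belief B m = Measure.dirac (lowestState m) := by
            rw [belief, if_neg]
            rintro ⟨j, hj, hj0⟩
            have := H.eq_of_eq hne (hmi.symm.trans hj)
            exact hj0 (this ▸ h0)
          rw [hb, integral_dirac, H.obey_eq hmi]
          exact E.mem_A_zero.2 ⟨(lowestState m).2.1,
            H.zero_le _ (hmi ▸ (isLeast_lowestState m).1)⟩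
        · exact absurd h0 (H.mean i hi0 hne).1
      · have hb : E.belief B m = cond E.prior (B i) := by
          rw [belief, if_pos ⟨i, hmi, h0⟩, hmi]
        rw [hb, H.obey_eq hmi]
        rcases eq_or_ne i 0 with rfl | hi0
        -- No mean condition is imposed on `B 0`: all its states are at most γ₁, hence so is their
        -- mean.
        · have := cond_isProbabilityMeasure h0
          have hae : ∀ᵐ ω : State ∂(cond E.prior (B 0)), (ω : ℝ) ≤ E.γ 1 := by
            filter_upwards [ae_cond_mem (μ := E.prior)
              (H.representation.closed 0).measurableSet] with ω hω using H.zero_le ω hω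
          refine E.mem_A_zero.2 ⟨integral_nonneg fun ω => ω.2.1, ?_⟩
          calc ∫ ω, (ω : ℝ) ∂(cond E.prior (B 0)) ≤ ∫ _, E.γ 1 ∂(cond E.prior (B 0)) :=
                integral_mono_ae
                  (integrable_state (F := fun t => t) continuous_id' measurable_id')
                  (integrable_const _) hae
            _ = E.γ 1 := by simp
        · exact (H.mean i hi0 hne).2
    · have hm' : ∀ i, (m : Set State) ≠ B i := fun i hi => hm ⟨i, hi⟩
      have hb : E.belief B m = Measure.dirac (lowestState m) := by
        rw [belief, if_neg]
        rintro ⟨j, hj, -⟩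
        exact hm' j hj
      rw [hb, integral_dirac]
      simp only [obey, hm', if_false]
      exact E.lowestAction_mem (lowestState m).2
  verifiable m := by
    change E.belief B m _ = 0
    unfold belief
    split_ifs
    · rw [cond_apply m.isCompact.isClosed.measurableSet, inter_compl_self, measure_empty, mul_zero]
    · rw [Measure.dirac_apply' _ m.isCompact.isClosed.measurableSet.compl]
      exact indicator_of_notMem (by simpa using (isLeast_lowestState m).1) _
  bayes := H.bayes_assessment

theorem isORE : E.IsORE H.assessment B where
  equilibrium := H.isEquilibrium
  representation := H.representation
  message i ω hω hj := by
    have hi : highest B ω = i := by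
      refine le_antisymm ?_ (le_highest hω)
      by_contra hlt
      exact hj _ (not_le.1 hlt) (H.mem_highest ω)
    change Measure.dirac (asMessage B (highest B ω)) _ = 1
    refine Measure.dirac_apply_of_mem ?_
    rw [hi]
    exact coe_asMessage (H.representation.closed i) ⟨ω, hω⟩
  action i m hm := by
    change Measure.dirac (E.obey B m) {i} = 1
    exact Measure.dirac_apply_of_mem (H.obey_eq hm)

theorem outcome_payoff : (E.outcome H.assessment).2 =
    E.v 1 * E.prior.real (B 1) + E.v 2 * E.prior.real (B 2) := by
  have hhi := measurable_highest H.representation.closed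
  change ∫ m, E.payoff H.assessment m ∂(E.messageLaw H.assessment) = _
  rw [H.messageLaw_eq, integral_map H.measurable_message.aemeasurable
    (E.measurable_payoff _).aestronglyMeasurable]
  have h1 : ∀ ω, E.payoff H.assessment (asMessage B (highest B ω)) = E.v (highest B ω) := by
    intro ω
    rw [H.payoff_assessment, H.obey_eq (H.coe_message ω)]
  simp_rw [h1]
  have h2 := integral_map (μ := E.prior) hhi.aemeasurable
    (f := E.v) (measurable_of_finite E.v).aestronglyMeasurable
  have := Measure.isProbabilityMeasure_map (μ := E.prior) hhi.aemeasurable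
  rw [← h2, integral_fintype Integrable.of_finite, Fin.sum_univ_three]
  have h3 : ∀ i, (E.prior.map (highest B)).real {i} = E.prior.real (B i) := by
    intro i
    rw [map_measureReal_apply hhi (measurableSet_singleton i)]
    exact measureReal_congr (H.highest_fiber_ae i)
  simp only [h3, smul_eq_mul, E.v_zero 0 rfl]
  ring

end IsObedient

end Environment

/-! ### Nested recommendations as equilibria. -/

namespace Environment

theorem condMean_eq {n : ℕ} (E : Environment n) (S : Set State) :
    E.condMean S = (E.prior.real S)⁻¹ * ∫ ω in S, (ω : ℝ) ∂E.prior := by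
  rw [condMean, ProbabilityTheory.cond, integral_smul_measure, ENNReal.toReal_inv, smul_eq_mul]
  rfl

theorem le_condMean {n : ℕ} (E : Environment n) {S : Set State} {c : ℝ} (h0 : 0 < E.prior.real S)
    (h : c * E.prior.real S ≤ ∫ ω in S, (ω : ℝ) ∂E.prior) : c ≤ E.condMean S := by
  rw [condMean_eq, inv_mul_eq_div, le_div_iff₀ h0]
  exact h

theorem condMean_le {n : ℕ} (E : Environment n) {S : Set State} {c : ℝ} (h0 : 0 < E.prior.real S)
    (h : ∫ ω in S, (ω : ℝ) ∂E.prior ≤ c * E.prior.real S) : E.condMean S ≤ c := by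
  rw [condMean_eq, inv_mul_eq_div, div_le_iff₀ h0]
  exact h

variable {n : ℕ} (E : Environment n)

theorem setIntegral_states {S : Set ℝ} (hS : MeasurableSet S) :
    ∫ ω in states S, (ω : ℝ) ∂E.prior = ∫ t in S, t ∂E.realPrior :=
  (setIntegral_map hS measurable_id.aestronglyMeasurable measurable_subtype_coe.aemeasurable).symm

theorem real_states {S : Set ℝ} (hS : MeasurableSet S) :
    E.prior.real (states S) = E.realPrior.real S :=
  (map_measureReal_apply measurable_subtype_coe hS).symm

theorem real_states_Icc {a b : ℝ} (hab : a ≤ b) :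
    E.prior.real (states (Icc a b)) = E.mass b - E.mass a := by
  rw [E.real_states measurableSet_Icc, E.mass_sub hab]

theorem integral_states_Icc {a b : ℝ} (hab : a ≤ b) :
    ∫ ω in states (Icc a b), (ω : ℝ) ∂E.prior = E.moment b - E.moment a := by
  rw [E.setIntegral_states measurableSet_Icc, E.moment_sub hab]

theorem aedisjoint_Icc {y h g : ℝ} (hg : h ≤ g) :
    AEDisjoint E.realPrior (Icc y h) (Icc g 1) := by
  refine measure_mono_null (t := {h}) ?_ (measure_singleton h)
  rintro t ⟨h1, h2⟩
  exact le_antisymm h1.2 (hg.trans h2.1)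

theorem real_states_union {y h g : ℝ} (hy : y ≤ h) (hg : h ≤ g) (h1 : g ≤ 1) :
    E.prior.real (states (Icc y h ∪ Icc g 1)) = E.mass h - E.mass y + 1 - E.mass g := by
  rw [E.real_states (measurableSet_Icc.union measurableSet_Icc), measureReal_def,
    measure_union₀ measurableSet_Icc.nullMeasurableSet (E.aedisjoint_Icc hg),
    ENNReal.toReal_add (measure_ne_top _ _) (measure_ne_top _ _), ← measureReal_def,
    ← measureReal_def, ← E.mass_sub hy, ← E.mass_sub h1, E.isCumulative.mass_one]
  ring

theorem integral_states_union {y h g : ℝ} (hy : y ≤ h) (hg : h ≤ g) (h1 : g ≤ 1) :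
    ∫ ω in states (Icc y h ∪ Icc g 1), (ω : ℝ) ∂E.prior =
      E.moment h - E.moment y + E.moment 1 - E.moment g := by
  rw [E.setIntegral_states (measurableSet_Icc.union measurableSet_Icc),
    setIntegral_union₀ (E.aedisjoint_Icc hg) measurableSet_Icc.nullMeasurableSet
      E.integrable_id_realPrior.integrableOn E.integrable_id_realPrior.integrableOn,
    ← E.moment_sub hy, ← E.moment_sub h1]
  ring

theorem prior_null_of_subset {a b c : ℝ} {S : Set State} (hS : S ⊆ states {a, b, c}) :
    E.prior S = 0 := by
  refine measure_mono_null hS ?_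
  rw [← E.realPrior_apply (by measurability)]
  exact (Set.toFinite _).measure_zero _

theorem isClosed_states {S : Set ℝ} (hS : IsClosed S) : IsClosed (states S) :=
  hS.preimage continuous_subtype_val

end Environment

/-- The outer set must have mean 1, impossible for positive mass since the prior is atomless; so
both of its intervals shrink to points. -/
theorem IsNested.eq_of_cutoff_eq_one {P T : ℝ → ℝ} (H : IsCumulative P T) {c₁ y h g : ℝ}
    (hN : IsNested P T c₁ 1 y h g) : y = h ∧ g = 1 := by
  have ho := hN.outer
  have h1 : h ≤ 1 := hN.h_le.trans hN.g_le
  have hA : T h - T y ≤ P h - P y := by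
    rcases hN.y_le.eq_or_lt with he | hlt
    · rw [he]
      simp
    · have := H.upper hN.nonneg hlt h1
      have := H.mass_lt hN.nonneg hlt h1
      nlinarith
  have hB : T 1 - T g ≤ 1 - P g := by
    rcases hN.g_le.eq_or_lt with he | hlt
    · rw [he, H.mass_one]
      simp
    · have := H.upper (hN.nonneg.trans (hN.y_le.trans hN.h_le)) hlt le_rfl
      rw [H.mass_one] at this
      linarith
  constructor
  · rcases hN.y_le.eq_or_lt with he | hlt
    · exact he
    · have h2 := H.upper hN.nonneg hlt h1
      have h3 := H.mass_lt hN.nonneg hlt h1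
      nlinarith
  · rcases hN.g_le.eq_or_lt with he | hlt
    · exact he
    · have h2 := H.upper (hN.nonneg.trans (hN.y_le.trans hN.h_le)) hlt le_rfl
      rw [H.mass_one] at h2
      linarith

open Classical in
/-- The recommendations `[0, y]`, `[h, g]`, `[y, h] ∪ [g, 1]` without null messages. -/
def nestedSets (c y h g : ℝ) : Fin 3 → Set State :=
  ![states (Icc 0 y), if h < g then states (Icc h g) else ∅,
    if c < 1 then states (Icc y h ∪ Icc g 1) else ∅]

theorem nestedSets_eq {c y h g : ℝ} (hg : h < g) (hc : c < 1) :
    nestedSets c y h g = nestedRep y h g := by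
  simp [nestedSets, nestedRep, hg, hc]

namespace Environment

variable (E : Environment 3) {y h g : ℝ}

variable {E} (hN : IsNested E.mass E.moment (E.γ 1) (E.γ 2) y h g)
include hN

/-- Bayes' rule does not discipline null recommendations, and such a set, for example {h} with h <
γ₁, may contain no state that justifies its action. This is why `nestedSets` empties them; when γ₂ <
1 the outer set has positive mass because g ≤ γ₂. -/
theorem nestedSets_isObedient : E.IsObedient (nestedSets (E.γ 2) y h g) := by
  have hc2 := E.cutoff_two_le_one
  have H := E.isCumulative
  have hy0 := hN.nonneg
  have hyh := hN.y_le
  have hhg := hN.h_le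
  have hg2 := hN.g_le
  have hy1 := hN.y_le_cutoff
  have hg1 : g ≤ 1 := hg2.trans hc2
  have degenerate : ¬ E.γ 2 < 1 → y = h ∧ g = 1 := by
    intro hlt
    have he : E.γ 2 = 1 := le_antisymm hc2 (not_lt.1 hlt)
    exact IsNested.eq_of_cutoff_eq_one H (he ▸ hN)
  have inB0 : ∀ ω : State, ω ∈ nestedSets (E.γ 2) y h g 0 ↔ (ω : ℝ) ≤ y := by
    intro ω
    exact ⟨fun hω => hω.2, fun hω => ⟨ω.2.1, hω⟩⟩
  have inB1 : ∀ ω : State, ω ∈ nestedSets (E.γ 2) y h g 1 ↔ h < g ∧ h ≤ ω ∧ (ω : ℝ) ≤ g := by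
    intro ω
    by_cases hlt : h < g
    · simp [nestedSets, hlt, states]
    · simp [nestedSets, hlt]
  have inB2 : ∀ ω : State, ω ∈ nestedSets (E.γ 2) y h g 2 ↔
      E.γ 2 < 1 ∧ ((y ≤ ω ∧ (ω : ℝ) ≤ h) ∨ g ≤ ω) := by
    intro ω
    by_cases hlt : E.γ 2 < 1
    · simp [nestedSets, hlt, states, ω.2.2]
    · simp [nestedSets, hlt]
  have upper : ∀ ω : State, y < ω → ω ∈ nestedSets (E.γ 2) y h g 1 ∨
      ω ∈ nestedSets (E.γ 2) y h g 2 := by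
    intro ω hω
    rw [inB1, inB2]
    by_cases hlt : E.γ 2 < 1
    · rcases le_or_gt (ω : ℝ) h with h1 | h1
      · exact Or.inr ⟨hlt, Or.inl ⟨hω.le, h1⟩⟩
      · rcases le_or_gt g ω with h2 | h2
        · exact Or.inr ⟨hlt, Or.inr h2⟩
        · exact Or.inl ⟨by linarith, h1.le, h2.le⟩
    · obtain ⟨rfl, rfl⟩ := degenerate hlt
      exact Or.inl ⟨lt_of_lt_of_le hω ω.2.2, hω.le, ω.2.2⟩
  refine ⟨⟨?_, ?_, ?_⟩, ?_, ?_, ?_, ?_⟩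
  · intro i
    fin_cases i
    · exact isClosed_states isClosed_Icc
    · by_cases hlt : h < g
      · simpa [nestedSets, hlt] using isClosed_states isClosed_Icc
      · simp [nestedSets, hlt]
    · by_cases hlt : E.γ 2 < 1
      · simpa [nestedSets, hlt] using isClosed_states (isClosed_Icc.union isClosed_Icc)
      · simp [nestedSets, hlt]
  · refine eq_univ_of_forall fun ω => ?_
    rcases le_or_gt (ω : ℝ) y with h1 | h1
    · exact mem_iUnion.2 ⟨0, (inB0 ω).2 h1⟩
    · rcases upper ω h1 with h2 | h2
      · exact mem_iUnion.2 ⟨1, h2⟩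
      · exact mem_iUnion.2 ⟨2, h2⟩
  · have n01 : E.prior (nestedSets (E.γ 2) y h g 0 ∩ nestedSets (E.γ 2) y h g 1) = 0 := by
      refine E.prior_null_of_subset (a := y) (b := h) (c := g) ?_
      rintro ω ⟨h0, h1⟩
      rw [inB0] at h0
      rw [inB1] at h1
      exact Or.inl (le_antisymm h0 (hyh.trans h1.2.1))
    have n02 : E.prior (nestedSets (E.γ 2) y h g 0 ∩ nestedSets (E.γ 2) y h g 2) = 0 := by
      refine E.prior_null_of_subset (a := y) (b := h) (c := g) ?_
      rintro ω ⟨h0, h1⟩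
      rw [inB0] at h0
      rw [inB2] at h1
      refine Or.inl (le_antisymm h0 ?_)
      rcases h1.2 with h1 | h1 <;> linarith
    have n12 : E.prior (nestedSets (E.γ 2) y h g 1 ∩ nestedSets (E.γ 2) y h g 2) = 0 := by
      refine E.prior_null_of_subset (a := y) (b := h) (c := g) ?_
      rintro ω ⟨h0, h1⟩
      rw [inB1] at h0
      rw [inB2] at h1
      rcases h1.2 with h1 | h1
      · exact Or.inr (Or.inl (le_antisymm h1.2 h0.2.1))
      · exact Or.inr (Or.inr (le_antisymm h0.2.2 h1))
    intro i j hij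
    fin_cases i <;> fin_cases j
    · exact absurd rfl hij
    · exact n01
    · exact n02
    · exact inter_comm (nestedSets (E.γ 2) y h g 0) _ ▸ n01
    · exact absurd rfl hij
    · exact n12
    · exact inter_comm (nestedSets (E.γ 2) y h g 0) _ ▸ n02
    · exact inter_comm (nestedSets (E.γ 2) y h g 1) _ ▸ n12
    · exact absurd rfl hij
  · intro ω hω
    exact ((inB0 ω).1 hω).trans hy1
  · intro ω hω
    exact upper ω (hy1.trans_lt hω)
  · intro ω hω
    rw [inB2]
    exact ⟨hω.trans_le ω.2.2, Or.inr (hg2.trans hω.le)⟩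
  · intro i hi hne
    have hh0 : 0 ≤ h := hy0.trans hyh
    fin_cases i
    · exact absurd rfl hi
    · obtain ⟨ω, hω⟩ := hne
      have hlt := ((inB1 ω).1 hω).1
      have hB : nestedSets (E.γ 2) y h g 1 = states (Icc h g) := by simp [nestedSets, hlt]
      change E.prior (nestedSets (E.γ 2) y h g 1) ≠ 0 ∧
        E.condMean (nestedSets (E.γ 2) y h g 1) ∈ E.A 1
      rw [hB]
      have hm := E.real_states_Icc hhg
      have hi := E.integral_states_Icc hhg
      have hlt' := H.mass_lt hh0 hlt hg1
      have hpos : 0 < E.prior.real (states (Icc h g)) := by linarith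
      refine ⟨fun h0 => ?_, E.mem_A_one.2 ⟨E.le_condMean hpos ?_, E.condMean_le hpos ?_⟩⟩
      · rw [measureReal_def, h0] at hpos
        simp at hpos
      · rw [hm, hi]
        exact hN.middle
      · rw [hm, hi]
        have := H.upper hh0 hlt hg1
        nlinarith
    · obtain ⟨ω, hω⟩ := hne
      have hlt := ((inB2 ω).1 hω).1
      have hB : nestedSets (E.γ 2) y h g 2 = states (Icc y h ∪ Icc g 1) := by
        simp [nestedSets, hlt]
      change E.prior (nestedSets (E.γ 2) y h g 2) ≠ 0 ∧
        E.condMean (nestedSets (E.γ 2) y h g 2) ∈ E.A 2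
      rw [hB]
      have hm := E.real_states_union hyh hhg hg1
      have hi := E.integral_states_union hyh hhg hg1
      have h1 := H.mass_lt (hh0.trans hhg) (hg2.trans_lt hlt) le_rfl
      have h2 := H.mass_le hy0 hyh (hhg.trans hg1)
      rw [H.mass_one] at h1
      have hpos : 0 < E.prior.real (states (Icc y h ∪ Icc g 1)) := by linarith
      refine ⟨fun h0 => ?_, E.mem_A_two.2 ⟨E.le_condMean hpos ?_, E.condMean_le hpos ?_⟩⟩
      · rw [measureReal_def, h0] at hpos
        simp at hpos
      · rw [hm, hi]
        exact hN.outer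
      · rw [one_mul]
        calc ∫ ω in states (Icc y h ∪ Icc g 1), (ω : ℝ) ∂E.prior
            ≤ ∫ _ in states (Icc y h ∪ Icc g 1), (1 : ℝ) ∂E.prior :=
              integral_mono (integrable_state (F := fun t => t) continuous_id' measurable_id')
                (integrable_const 1) fun ω => ω.2.2
          _ = _ := by simp

theorem outcome_payoff_nested : (E.outcome (nestedSets_isObedient hN).assessment).2 =
    nestedValue E.mass (E.v 1) (E.v 2) y h g := by
  rw [IsObedient.outcome_payoff, nestedValue]
  have h1 : E.prior.real (nestedSets (E.γ 2) y h g 1) = E.mass g - E.mass h := by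
    rcases hN.h_le.eq_or_lt with he | hlt
    · simp [nestedSets, he]
    · rw [← E.real_states_Icc hN.h_le]
      simp [nestedSets, hlt]
  have h2 : E.prior.real (nestedSets (E.γ 2) y h g 2) =
      E.mass h - E.mass y + 1 - E.mass g := by
    by_cases hlt : E.γ 2 < 1
    · rw [← E.real_states_union hN.y_le hN.h_le (hN.g_le.trans E.cutoff_two_le_one)]
      simp [nestedSets, hlt]
    · have he : E.γ 2 = 1 := le_antisymm E.cutoff_two_le_one (not_lt.1 hlt)
      obtain ⟨hyh, hg⟩ := IsNested.eq_of_cutoff_eq_one E.isCumulative (he ▸ hN)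
      rw [hyh, hg, E.isCumulative.mass_one]
      simp [nestedSets, hlt]
  rw [h1, h2]

end Environment

/-! ### Multipliers in the binding case. -/

/-- The prices of the two mean constraints at a binding nested recommendation. -/
theorem IsBindingNested.exists_prices {P T : ℝ → ℝ} {c₁ c₂ v₁ v₂ y h : ℝ}
    (H : IsBindingNested P T c₁ c₂ v₁ v₂ y h) (hv1 : 0 < v₁) (hv : v₁ < v₂) :
    ∃ l₁ l₂, 0 < l₂ ∧ l₂ < l₁ ∧ v₂ + l₂ * (y - c₂) = 0 ∧
      v₁ + l₁ * (h - c₁) = v₂ + l₂ * (h - c₂) := by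
  have h1 := H.y_lt
  have h2 := H.h_lt
  have h3 := H.cutoff_lt
  have d1 : 0 < c₂ - y := by linarith
  have d2 : 0 < c₁ - h := by linarith
  -- The priced line of a₂ passes through (y, 0) and (c₂, v₂), so that a₀ and a₂ tie at y.
  set l₂ := v₂ / (c₂ - y) with hl2
  have e2 : l₂ * (c₂ - y) = v₂ := by rw [hl2]; field_simp
  have hpos : 0 < l₂ := div_pos (by linarith) d1
  -- By the price condition this line lies below v₁ at c₁. The line of a₁ through (c₁, v₁) that
  -- meets it at h < c₁ is therefore steeper: l₂ < l₁.
  have hlt : v₂ - v₁ < l₂ * (c₂ - c₁) := by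
    rw [hl2, div_mul_eq_mul_div, lt_div_iff₀ d1]
    nlinarith [H.price]
  set l₁ := (v₁ - v₂ + l₂ * (c₂ - h)) / (c₁ - h) with hl1
  have e1 : l₁ * (c₁ - h) = v₁ - v₂ + l₂ * (c₂ - h) := by rw [hl1]; field_simp
  refine ⟨l₁, l₂, hpos, ?_, by linarith, by linarith⟩
  rw [hl1, lt_div_iff₀ d2]
  linarith

/-! ### What equilibrium imposes on states and messages jointly. -/

namespace Environment

section Joint

variable {n : ℕ} {E : Environment n} {e : Assessment n}

theorem ae_joint_of_ae_message {p : Message → Prop} (h : ∀ᵐ m ∂(E.messageLaw e), p m) :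
    ∀ᵐ q ∂(E.prior ⊗ₘ e.σ), p q.2 := by
  rw [messageLaw, ← Measure.snd_compProd E.prior e.σ] at h
  exact ae_of_ae_map measurable_snd.aemeasurable h

theorem ae_joint_of_ae_state {p : State → Prop} (h : ∀ᵐ ω ∂E.prior, p ω) :
    ∀ᵐ q ∂(E.prior ⊗ₘ e.σ), p q.1 := by
  rw [← Measure.fst_compProd E.prior e.σ] at h
  exact ae_of_ae_map measurable_fst.aemeasurable h

theorem messageLaw_apply {S : Set Message} (hS : MeasurableSet S) :
    E.messageLaw e S = (E.prior ⊗ₘ e.σ) (Prod.snd ⁻¹' S) := by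
  rw [messageLaw, ← Measure.snd_compProd E.prior e.σ]
  exact Measure.map_apply measurable_snd hS

theorem prior_apply_eq_joint {S : Set State} (hS : MeasurableSet S) :
    E.prior S = (E.prior ⊗ₘ e.σ) (Prod.fst ⁻¹' S) := by
  conv_lhs => rw [← Measure.fst_compProd E.prior e.σ]
  exact Measure.map_apply measurable_fst hS

theorem ae_state_ne (a : ℝ) : ∀ᵐ ω ∂E.prior, (ω : State) ≠ a := by
  have : ∀ᵐ t ∂E.realPrior, t ≠ a := by
    rw [ae_iff]
    simp
  exact ae_of_ae_map measurable_subtype_coe.aemeasurable this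

theorem measurable_indicator_joint {S : Set Message} (hS : MeasurableSet S) (c : ℝ) :
    Measurable fun q : State × Message => S.indicator (fun _ => (q.1 : ℝ) - c) q.2 := by
  have : (fun q : State × Message => S.indicator (fun _ => (q.1 : ℝ) - c) q.2) =
      (Prod.snd ⁻¹' S).indicator fun q : State × Message => (q.1 : ℝ) - c := by
    ext q
    by_cases hq : q.2 ∈ S <;> simp [hq]
  rw [this]
  exact ((measurable_subtype_coe.comp measurable_fst).sub_const c).indicator (measurable_snd hS)

theorem integrable_indicator_joint {S : Set Message} (hS : MeasurableSet S) (c : ℝ) :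
    Integrable (fun q : State × Message => S.indicator (fun _ => (q.1 : ℝ) - c) q.2)
      (E.prior ⊗ₘ e.σ) := by
  refine Integrable.of_bound (C := 1 + |c|) (measurable_indicator_joint hS c).aestronglyMeasurable
    (Filter.Eventually.of_forall fun q => ?_)
  refine (norm_indicator_le_norm_self (s := S) (fun _ => (q.1 : ℝ) - c) q.2).trans ?_
  refine (norm_sub_le _ _).trans ?_
  rw [Real.norm_eq_abs, Real.norm_eq_abs, abs_of_nonneg q.1.2.1]
  linarith [q.1.2.2]

/-- Messages with mean at least `c` cannot come only from states at most `c`. -/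
theorem IsEquilibrium.ae_notMem_of_mean (h : E.IsEquilibrium e) {S : Set Message}
    (hS : MeasurableSet S) {c : ℝ} (hmean : ∀ m ∈ S, c ≤ posteriorMean e m)
    (hle : ∀ᵐ q ∂(E.prior ⊗ₘ e.σ), q.2 ∈ S → (q.1 : ℝ) ≤ c) :
    ∀ᵐ m ∂(E.messageLaw e), m ∉ S := by
  have hint := h.integral_indicator_mean hS c
  have hge : 0 ≤ ∫ m, S.indicator (fun m => posteriorMean e m - c) m ∂(E.messageLaw e) :=
    integral_nonneg fun m => indicator_nonneg (fun m hm => sub_nonneg.2 (hmean m hm)) m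
  have hnn : 0 ≤ᵐ[E.prior ⊗ₘ e.σ]
      fun q : State × Message => -S.indicator (fun _ => (q.1 : ℝ) - c) q.2 := by
    filter_upwards [hle] with q hq
    by_cases hqS : q.2 ∈ S
    · simpa [hqS] using hq hqS
    · simp [hqS]
  have hzero : ∫ q, -S.indicator (fun _ => ((q : State × Message).1 : ℝ) - c) q.2
      ∂(E.prior ⊗ₘ e.σ) = 0 := by
    refine le_antisymm ?_ (integral_nonneg_of_ae hnn)
    rw [integral_neg, hint]
    linarith
  have hz := (integral_eq_zero_iff_of_nonneg_ae hnn (integrable_indicator_joint hS c).neg).1 hzero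
  -- Averaging has forced the state to equal c on these messages, and the prior has no atom at c.
  have hne := ae_joint_of_ae_state (e := e) (E.ae_state_ne c)
  rw [ae_iff]
  simp only [not_not, ofPred_mem_eq]
  rw [messageLaw_apply hS, measure_eq_zero_iff_ae_notMem]
  filter_upwards [hz, hne] with q hq hqc hqS
  have hqS' : q.2 ∈ S := hqS
  simp only [hqS', indicator_of_mem, Pi.zero_apply, neg_eq_zero, sub_eq_zero] at hq
  exact hqc hq

/-- Verifiability pins down the belief after {ω} even off path, so revealing the state is always a
credible deviation. -/
theorem IsEquilibrium.posteriorMean_singleton (h : E.IsEquilibrium e) (ω : State) :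
    posteriorMean e {ω} = ω := by
  have hae : ∀ᵐ x : State ∂(e.p {ω}), (x : ℝ) = ω := by
    have h0 := h.verifiable {ω}
    rw [ae_iff]
    refine measure_mono_null (fun x hx => ?_) h0
    simp only [TopologicalSpace.NonemptyCompacts.coe_singleton, mem_compl_iff, mem_singleton_iff]
    rintro rfl
    exact hx rfl
  unfold posteriorMean
  rw [integral_congr_ae hae]
  simp

end Joint

section ThreeActions

variable {E : Environment 3} {e : Assessment 3}

theorem fin_three_cases {i : Fin 3} : i = 0 ∨ i = 1 ∨ i = 2 := by
  fin_cases i <;> simp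

theorem payoff_nonneg (m : Message) : 0 ≤ E.payoff e m := by
  refine E.le_payoff_of_forall e fun i _ => ?_
  rw [← E.v_zero 0 rfl]
  exact E.v_strictMono.monotone (Fin.zero_le i)

theorem payoff_le_two (m : Message) : E.payoff e m ≤ E.v 2 :=
  E.payoff_le_of_forall e fun i _ => E.v_strictMono.monotone (Fin.le_last i)

theorem IsEquilibrium.cutoff_one_le_of_pos (h : E.IsEquilibrium e) {m : Message}
    (hm : 0 < E.payoff e m) : E.γ 1 ≤ posteriorMean e m := by
  by_contra hlt
  refine hm.not_ge (E.payoff_le_of_forall e fun i hi => ?_)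
  have hA := h.receiver m i hi
  have := E.cutoff_one_le_two
  rcases fin_three_cases (i := i) with rfl | rfl | rfl
  · exact (E.v_zero 0 rfl).le
  · exact absurd (E.mem_A_one.1 hA).1 hlt
  · exact absurd (this.trans (E.mem_A_two.1 hA).1) hlt

theorem IsEquilibrium.cutoff_two_le_of_lt (h : E.IsEquilibrium e) {m : Message}
    (hm : E.v 1 < E.payoff e m) : E.γ 2 ≤ posteriorMean e m := by
  by_contra hlt
  refine hm.not_ge (E.payoff_le_of_forall e fun i hi => ?_)
  have hA := h.receiver m i hi
  rcases fin_three_cases (i := i) with rfl | rfl | rfl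
  · exact E.v_strictMono.monotone (by decide)
  · exact le_rfl
  · exact absurd (E.mem_A_two.1 hA).1 hlt

/-- A state above a cutoff obtains at least the payoff from revealing it. -/
theorem IsEquilibrium.ae_reveal (h : E.IsEquilibrium e) :
    ∀ᵐ q ∂(E.prior ⊗ₘ e.σ), (E.γ 1 < q.1 → E.v 1 ≤ E.payoff e q.2) ∧
      (E.γ 2 < q.1 → E.v 2 ≤ E.payoff e q.2) := by
  have hm1 : Measurable fun q : State × Message => (q.1 : ℝ) :=
    measurable_subtype_coe.comp measurable_fst
  have hm2 : Measurable fun q : State × Message => E.payoff e q.2 :=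
    (E.measurable_payoff e).comp measurable_snd
  have hms : ∀ c v : ℝ, MeasurableSet {q : State × Message | c < q.1 → v ≤ E.payoff e q.2} := by
    intro c v
    have : {q : State × Message | c < q.1 → v ≤ E.payoff e q.2} =
        {q : State × Message | (q.1 : ℝ) ≤ c} ∪ {q | v ≤ E.payoff e q.2} := by
      ext q
      simp only [mem_ofPred_eq, mem_union, ← not_lt (a := c), imp_iff_not_or]
    rw [this]
    exact (measurableSet_le hm1 measurable_const).union (measurableSet_le measurable_const hm2)
  refine Measure.ae_compProd_of_ae_ae ((hms _ _).inter (hms _ _))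
    (Filter.Eventually.of_forall fun ω => ?_)
  filter_upwards [h.sender ω] with m hm
  have hs := hm {ω} (by simp [← SetLike.mem_coe])
  have hmean := h.posteriorMean_singleton ω
  constructor
  · intro hω
    refine le_trans (E.le_payoff_of_forall e fun i hi => ?_) hs
    have hA := h.receiver _ i hi
    rw [hmean] at hA
    rcases fin_three_cases (i := i) with rfl | rfl | rfl
    · exact absurd (E.mem_A_zero.1 hA).2 (not_le.2 hω)
    · exact le_rfl
    · exact E.payoff_one_lt_two.le
  · intro hω
    refine le_trans (E.le_payoff_of_forall e fun i hi => ?_) hs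
    have hA := h.receiver _ i hi
    rw [hmean] at hA
    have := E.cutoff_one_le_two
    rcases fin_three_cases (i := i) with rfl | rfl | rfl
    · exact absurd (E.mem_A_zero.1 hA).2 (not_le.2 (this.trans_lt hω))
    · exact absurd (E.mem_A_one.1 hA).2 (not_le.2 hω)
    · exact le_rfl

/-- Almost surely Sender obtains the payoff of a pure action. -/
theorem IsEquilibrium.ae_payoff (h : E.IsEquilibrium e) :
    ∀ᵐ m ∂(E.messageLaw e), E.payoff e m = 0 ∨ E.payoff e m = E.v 1 ∨ E.payoff e m = E.v 2 := by
  have hm := E.measurable_payoff e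
  -- A payoff strictly between v₁ and v₂ requires mean at least γ₂, yet states above γ₂ would rather
  -- reveal themselves. Such messages come only from states at most γ₂ and are null.
  have h1 : ∀ᵐ m ∂(E.messageLaw e), m ∉ E.payoff e ⁻¹' Ioo (E.v 1) (E.v 2) := by
    refine h.ae_notMem_of_mean (hm measurableSet_Ioo)
      (fun m hm => h.cutoff_two_le_of_lt hm.1) ?_
    filter_upwards [h.ae_reveal] with q hq hqS
    by_contra hlt
    exact not_le.2 hqS.2 (hq.2 (not_le.1 hlt))
  have h0 : ∀ᵐ m ∂(E.messageLaw e), m ∉ E.payoff e ⁻¹' Ioo 0 (E.v 1) := by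
    refine h.ae_notMem_of_mean (hm measurableSet_Ioo)
      (fun m hm => h.cutoff_one_le_of_pos hm.1) ?_
    filter_upwards [h.ae_reveal] with q hq hqS
    by_contra hlt
    exact not_le.2 hqS.2 (hq.1 (not_le.1 hlt))
  filter_upwards [h0, h1] with m hm0 hm1
  simp only [mem_preimage, mem_Ioo, not_and, not_lt] at hm0 hm1
  rcases (E.payoff_nonneg (e := e) m).eq_or_lt with h | h
  · exact Or.inl h.symm
  rcases (hm0 h).eq_or_lt with h | h
  · exact Or.inr (Or.inl h.symm)
  · exact Or.inr (Or.inr (le_antisymm (payoff_le_two m) (hm1 h)))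

end ThreeActions

end Environment

/-! ### The Lagrangian bound and uniqueness in the binding case. -/

namespace Environment

variable {E : Environment 3} {y h : ℝ}

/-- The messages from which Sender's payoff is `v i`. -/
def messagesWithPayoff (E : Environment 3) (e : Assessment 3) (i : Fin 3) : Set Message :=
  E.payoff e ⁻¹' {E.v i}

theorem measurableSet_messagesWithPayoff (e : Assessment 3) (i : Fin 3) :
    MeasurableSet (E.messagesWithPayoff e i) :=
  E.measurable_payoff e (measurableSet_singleton _)

theorem integral_indicator_line {S : Set State} (hS : MeasurableSet S) (v l c : ℝ) :
    ∫ ω, S.indicator (fun ω : State => v + l * ((ω : ℝ) - c)) ω ∂E.prior =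
      v * E.prior.real S + l * (∫ ω in S, (ω : ℝ) ∂E.prior - c * E.prior.real S) := by
  have hi : Integrable (fun ω : State => (ω : ℝ)) (E.prior.restrict S) :=
    integrable_state (F := fun t => t) continuous_id' measurable_id'
  have hi' : Integrable (fun ω : State => (ω : ℝ) - c) (E.prior.restrict S) :=
    hi.sub (integrable_const c)
  rw [integral_indicator hS, integral_add (integrable_const v) (hi'.const_mul l),
    integral_const_mul,
    integral_sub hi (integrable_const c)]
  simp [mul_comm]

/-- The payoff of an assessment plus the value of its slack in the two mean constraints. -/
def pricedPayoff (E : Environment 3) (e : Assessment 3) (l₁ l₂ : ℝ) (q : State × Message) : ℝ :=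
  E.payoff e q.2 +
    l₁ * (E.messagesWithPayoff e 1).indicator (fun _ => (q.1 : ℝ) - E.γ 1) q.2 +
    l₂ * (E.messagesWithPayoff e 2).indicator (fun _ => (q.1 : ℝ) - E.γ 2) q.2

/-- The priced payoff of the recommended action in each state. -/
def priceOfState (E : Environment 3) (y h l₁ l₂ : ℝ) (ω : State) : ℝ :=
  (states (Icc h (E.γ 2))).indicator (fun ω : State => E.v 1 + l₁ * ((ω : ℝ) - E.γ 1)) ω +
    (states (Icc y h ∪ Icc (E.γ 2) 1)).indicator
      (fun ω : State => E.v 2 + l₂ * ((ω : ℝ) - E.γ 2)) ω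

theorem integrable_payoff_joint (e : Assessment 3) :
    Integrable (fun q : State × Message => E.payoff e q.2) (E.prior ⊗ₘ e.σ) := by
  have := E.integrable_payoff e (E.messageLaw e)
  rw [messageLaw, ← Measure.snd_compProd E.prior e.σ] at this
  exact this.comp_measurable measurable_snd

theorem integrable_pricedPayoff (e : Assessment 3) (l₁ l₂ : ℝ) :
    Integrable (E.pricedPayoff e l₁ l₂) (E.prior ⊗ₘ e.σ) := by
  have hp := integrable_payoff_joint (E := E) e
  exact (hp.add ((integrable_indicator_joint
    (measurableSet_messagesWithPayoff e 1) _).const_mul l₁)).add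
    ((integrable_indicator_joint (measurableSet_messagesWithPayoff e 2) _).const_mul l₂)

/-- By Bayes' rule the state can be replaced by the posterior mean on each class of messages, which
turns the priced terms into the slacks of Receiver's constraints. -/
theorem IsEquilibrium.integral_pricedPayoff {e : Assessment 3} (he : E.IsEquilibrium e)
    (l₁ l₂ : ℝ) : ∫ q, E.pricedPayoff e l₁ l₂ q ∂(E.prior ⊗ₘ e.σ) = (E.outcome e).2 +
      l₁ * ∫ m, (E.messagesWithPayoff e 1).indicator (fun m => posteriorMean e m - E.γ 1) m
        ∂(E.messageLaw e) +
      l₂ * ∫ m, (E.messagesWithPayoff e 2).indicator (fun m => posteriorMean e m - E.γ 2) m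
        ∂(E.messageLaw e) := by
  have hp := integrable_payoff_joint (E := E) e
  have h1 := (integrable_indicator_joint (E := E) (e := e)
    (measurableSet_messagesWithPayoff (E := E) e 1) (E.γ 1)).const_mul l₁
  have h2 := (integrable_indicator_joint (E := E) (e := e)
    (measurableSet_messagesWithPayoff (E := E) e 2) (E.γ 2)).const_mul l₂
  refine (integral_add (hp.add h1) h2).trans ?_
  rw [integral_add' hp h1, integral_const_mul, integral_const_mul,
    he.integral_indicator_mean (measurableSet_messagesWithPayoff e 1),
    he.integral_indicator_mean (measurableSet_messagesWithPayoff e 2),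
    integral_message_joint e (E.measurable_payoff e)]
  rfl

variable (hB : IsBindingNested E.mass E.moment (E.γ 1) (E.γ 2) (E.v 1) (E.v 2) y h)
include hB

theorem isNested_of_binding : IsNested E.mass E.moment (E.γ 1) (E.γ 2) y h (E.γ 2) :=
  ⟨hB.nonneg, hB.y_lt.le, (hB.h_lt.trans hB.cutoff_lt).le, le_rfl, (hB.y_lt.trans hB.h_lt).le,
    hB.middle.ge, hB.outer.ge⟩

/-- Both mean constraints bind, so the multipliers drop out and Sender's payoff from the
recommendation remains. -/
theorem integral_priceOfState (l₁ l₂ : ℝ) : ∫ ω, E.priceOfState y h l₁ l₂ ω ∂E.prior =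
    nestedValue E.mass (E.v 1) (E.v 2) y h (E.γ 2) := by
  have hlt := hB.h_lt.trans hB.cutoff_lt
  have m1 : MeasurableSet (states (Icc h (E.γ 2))) := measurableSet_states measurableSet_Icc
  have m2 : MeasurableSet (states (Icc y h ∪ Icc (E.γ 2) 1)) :=
    measurableSet_states (measurableSet_Icc.union measurableSet_Icc)
  have hline : ∀ v l c : ℝ, Integrable (fun ω : State => v + l * ((ω : ℝ) - c)) E.prior :=
    fun v l c => integrable_state (F := fun t => v + l * (t - c)) (by fun_prop) measurable_id'
  unfold priceOfState
  rw [integral_add ((hline _ _ _).indicator m1) ((hline _ _ _).indicator m2),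
    integral_indicator_line m1, integral_indicator_line m2, E.real_states_Icc hlt.le,
    E.integral_states_Icc hlt.le, E.real_states_union hB.y_lt.le hlt.le hB.cutoff_lt_one.le,
    E.integral_states_union hB.y_lt.le hlt.le hB.cutoff_lt_one.le, hB.middle, hB.outer, nestedValue]
  ring

/-- Almost surely the recommended action maximizes the priced payoff, uniquely. -/
theorem ae_pricedPayoff_le {l₁ l₂ : ℝ} (hl2 : 0 < l₂) (hl : l₂ < l₁)
    (hy : E.v 2 + l₂ * (y - E.γ 2) = 0)
    (hh : E.v 1 + l₁ * (h - E.γ 1) = E.v 2 + l₂ * (h - E.γ 2))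
    {e : Assessment 3} (he : E.IsEquilibrium e) :
    ∀ᵐ q ∂(E.prior ⊗ₘ e.σ), E.pricedPayoff e l₁ l₂ q ≤ E.priceOfState y h l₁ l₂ q.1 ∧
      (E.pricedPayoff e l₁ l₂ q = E.priceOfState y h l₁ l₂ q.1 →
        (q.2 ∈ E.messagesWithPayoff e 1 ↔ q.1 ∈ states (Icc h (E.γ 2))) ∧
        (q.2 ∈ E.messagesWithPayoff e 2 ↔ q.1 ∈ states (Icc y h ∪ Icc (E.γ 2) 1))) := by
  classical
  have hv1 := E.payoff_one_pos
  have hv2 := E.payoff_one_lt_two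
  have hyh := hB.y_lt
  have hh1 := hB.h_lt
  have h12 := hB.cutoff_lt
  filter_upwards [ae_joint_of_ae_state (e := e) (E.ae_state_ne y),
    ae_joint_of_ae_state (e := e) (E.ae_state_ne h),
    ae_joint_of_ae_state (e := e) (E.ae_state_ne (E.γ 2)), he.ae_reveal,
    ae_joint_of_ae_message he.ae_payoff] with q ny nh n2 hrev hpay
  have hq1 : (q.1 : ℝ) ≤ 1 := q.1.2.2
  have mem1 : q.2 ∈ E.messagesWithPayoff e 1 ↔ E.payoff e q.2 = E.v 1 := Iff.rfl
  have mem2 : q.2 ∈ E.messagesWithPayoff e 2 ↔ E.payoff e q.2 = E.v 2 := Iff.rfl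
  have in1 : q.1 ∈ states (Icc h (E.γ 2)) ↔ h ≤ q.1 ∧ (q.1 : ℝ) ≤ E.γ 2 := Iff.rfl
  have in2 : q.1 ∈ states (Icc y h ∪ Icc (E.γ 2) 1) ↔
      (y ≤ q.1 ∧ (q.1 : ℝ) ≤ h) ∨ (E.γ 2 ≤ q.1 ∧ (q.1 : ℝ) ≤ 1) := Iff.rfl
  unfold pricedPayoff priceOfState
  simp only [indicator_apply, mem1, mem2, in1, in2]
  generalize (q.1 : ℝ) = t at *
  rcases lt_or_gt_of_ne ny with c1 | c1
  · have a1 : ¬ (h ≤ t ∧ t ≤ E.γ 2) := fun hc => by linarith [hc.1]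
    have a2 : ¬ ((y ≤ t ∧ t ≤ h) ∨ (E.γ 2 ≤ t ∧ t ≤ 1)) := by
      rintro (hc | hc) <;> linarith [hc.1]
    have b1 : E.v 1 + l₁ * (t - E.γ 1) < 0 := by nlinarith
    have b2 : E.v 2 + l₂ * (t - E.γ 2) < 0 := by nlinarith
    simp only [a1, a2, if_false]
    rcases hpay with hp | hp | hp <;> rw [hp]
    · simp [hv1.ne, (hv1.trans hv2).ne]
    · simp only [hv2.ne, if_true, if_false]
      exact ⟨by linarith, fun hc => by linarith⟩
    · simp only [hv2.ne', if_true, if_false]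
      exact ⟨by linarith, fun hc => by linarith⟩
  rcases lt_or_gt_of_ne nh with c2 | c2
  · have a1 : ¬ (h ≤ t ∧ t ≤ E.γ 2) := fun hc => by linarith [hc.1]
    have a2 : ((y ≤ t ∧ t ≤ h) ∨ (E.γ 2 ≤ t ∧ t ≤ 1)) := Or.inl ⟨c1.le, c2.le⟩
    have b1 : E.v 1 + l₁ * (t - E.γ 1) < E.v 2 + l₂ * (t - E.γ 2) := by nlinarith
    have b2 : 0 < E.v 2 + l₂ * (t - E.γ 2) := by nlinarith
    simp only [a1, a2, if_false, if_true]
    rcases hpay with hp | hp | hp <;> rw [hp]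
    · simp only [hv1.ne, (hv1.trans hv2).ne, if_false]
      exact ⟨by linarith, fun hc => by linarith⟩
    · simp only [hv2.ne, if_true, if_false]
      exact ⟨by linarith, fun hc => by linarith⟩
    · simp only [hv2.ne', if_true, if_false]
      exact ⟨by linarith, fun hc => by simp⟩
  rcases lt_or_gt_of_ne n2 with c3 | c3
  · have a1 : (h ≤ t ∧ t ≤ E.γ 2) := ⟨c2.le, c3.le⟩
    have a2 : ¬ ((y ≤ t ∧ t ≤ h) ∨ (E.γ 2 ≤ t ∧ t ≤ 1)) := by
      rintro (hc | hc)
      · linarith [hc.2]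
      · linarith [hc.1]
    have b1 : E.v 2 + l₂ * (t - E.γ 2) < E.v 1 + l₁ * (t - E.γ 1) := by nlinarith
    have b2 : 0 < E.v 2 + l₂ * (t - E.γ 2) := by nlinarith
    simp only [a1, a2, if_false, and_self, if_true]
    rcases hpay with hp | hp | hp <;> rw [hp]
    · simp only [hv1.ne, (hv1.trans hv2).ne, if_false]
      exact ⟨by linarith, fun hc => by linarith⟩
    · simp only [hv2.ne, if_true, if_false]
      exact ⟨by linarith, fun hc => by simp⟩
    · simp only [hv2.ne', if_true, if_false]
      exact ⟨by linarith, fun hc => by linarith⟩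
  -- Above γ₂ the line of a₁ is the higher one, as l₂ < l₁, so the pointwise bound would fail under
  -- commitment. The option to reveal forces payoff v₂ here.
  · have a1 : ¬ (h ≤ t ∧ t ≤ E.γ 2) := fun hc => by linarith [hc.2]
    have a2 : ((y ≤ t ∧ t ≤ h) ∨ (E.γ 2 ≤ t ∧ t ≤ 1)) := Or.inr ⟨c3.le, hq1⟩
    have hp : E.payoff e q.2 = E.v 2 := le_antisymm (payoff_le_two _) (hrev.2 c3)
    simp only [a1, a2, if_false, if_true, hp, hv2.ne']
    exact ⟨by linarith, fun hc => by simp⟩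

/-- No equilibrium does better than a binding nested recommendation, and the law of the posterior
mean on `[γ₁, ∞)` is the same in all equilibria that do as well. -/
theorem IsEquilibrium.payoff_le_of_binding {e : Assessment 3} (he : E.IsEquilibrium e) :
    (E.outcome e).2 ≤ nestedValue E.mass (E.v 1) (E.v 2) y h (E.γ 2) ∧
    (nestedValue E.mass (E.v 1) (E.v 2) y h (E.γ 2) ≤ (E.outcome e).2 →
      (E.outcome e).1.restrict (Ici (E.γ 1)) =
        E.prior (states (Icc h (E.γ 2))) • Measure.dirac (E.γ 1) +
          E.prior (states (Icc y h ∪ Icc (E.γ 2) 1)) • Measure.dirac (E.γ 2)) := by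
  classical
  have hv1 := E.payoff_one_pos
  have hv2 := E.payoff_one_lt_two
  obtain ⟨l₁, l₂, hl2, hl, hy, hh⟩ := hB.exists_prices hv1 hv2
  have hl1 : 0 < l₁ := hl2.trans hl
  have hae := ae_pricedPayoff_le hB hl2 hl hy hh he
  have m1 : MeasurableSet (states (Icc h (E.γ 2))) := measurableSet_states measurableSet_Icc
  have m2 : MeasurableSet (states (Icc y h ∪ Icc (E.γ 2) 1)) :=
    measurableSet_states (measurableSet_Icc.union measurableSet_Icc)
  have mM := measurableSet_messagesWithPayoff (E := E) e
  set M := E.messagesWithPayoff e with hM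
  set D₁ := ∫ m, (M 1).indicator (fun m => posteriorMean e m - E.γ 1) m ∂(E.messageLaw e) with hD1
  set D₂ := ∫ m, (M 2).indicator (fun m => posteriorMean e m - E.γ 2) m ∂(E.messageLaw e) with hD2
  have mean1 : ∀ m ∈ M 1, E.γ 1 ≤ posteriorMean e m := fun m hm =>
    he.cutoff_one_le_of_pos (hv1.trans_eq (Eq.symm hm))
  have mean2 : ∀ m ∈ M 2, E.γ 2 ≤ posteriorMean e m := fun m hm =>
    he.cutoff_two_le_of_lt (hv2.trans_eq (Eq.symm hm))
  have n1 : ∀ m, 0 ≤ (M 1).indicator (fun m => posteriorMean e m - E.γ 1) m :=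
    fun m => indicator_nonneg (fun m hm => sub_nonneg.2 (mean1 m hm)) m
  have n2 : ∀ m, 0 ≤ (M 2).indicator (fun m => posteriorMean e m - E.γ 2) m :=
    fun m => indicator_nonneg (fun m hm => sub_nonneg.2 (mean2 m hm)) m
  have hD1' : 0 ≤ D₁ := integral_nonneg n1
  have hD2' : 0 ≤ D₂ := integral_nonneg n2
  have hline : ∀ v l c : ℝ, Continuous fun t : ℝ => v + l * (t - c) := fun v l c => by fun_prop
  have mPrice : Measurable (E.priceOfState y h l₁ l₂) :=
    (((hline _ _ _).measurable.comp measurable_subtype_coe).indicator m1).add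
      (((hline _ _ _).measurable.comp measurable_subtype_coe).indicator m2)
  have iPrice : Integrable (fun q : State × Message => E.priceOfState y h l₁ l₂ q.1)
      (E.prior ⊗ₘ e.σ) :=
    ((integrable_state (hline _ _ _) measurable_fst).indicator (measurable_fst m1)).add
      ((integrable_state (hline _ _ _) measurable_fst).indicator (measurable_fst m2))
  have iPay := integrable_pricedPayoff (E := E) e l₁ l₂
  have nn : 0 ≤ᵐ[E.prior ⊗ₘ e.σ]
      fun q => E.priceOfState y h l₁ l₂ q.1 - E.pricedPayoff e l₁ l₂ q := by
    filter_upwards [hae] with q hq using sub_nonneg.2 hq.1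
  have hgap : ∫ q, (E.priceOfState y h l₁ l₂ q.1 - E.pricedPayoff e l₁ l₂ q)
      ∂(E.prior ⊗ₘ e.σ) = nestedValue E.mass (E.v 1) (E.v 2) y h (E.γ 2) -
        ((E.outcome e).2 + l₁ * D₁ + l₂ * D₂) := by
    rw [integral_sub iPrice iPay, integral_state_joint e mPrice, integral_priceOfState hB,
      he.integral_pricedPayoff]
  have hgap0 := integral_nonneg_of_ae nn
  have p1 := mul_nonneg hl1.le hD1'
  have p2 := mul_nonneg hl2.le hD2'
  refine ⟨by linarith, fun hopt => ?_⟩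
  -- The gap and both priced slacks are nonnegative and sum to nestedValue minus R, so at the
  -- optimum all vanish.
  have z1 : D₁ = 0 := by
    have : l₁ * D₁ = 0 := by linarith
    exact (mul_eq_zero.1 this).resolve_left hl1.ne'
  have z2 : D₂ = 0 := by
    have : l₂ * D₂ = 0 := by linarith
    exact (mul_eq_zero.1 this).resolve_left hl2.ne'
  have z3 : ∫ q, (E.priceOfState y h l₁ l₂ q.1 - E.pricedPayoff e l₁ l₂ q)
      ∂(E.prior ⊗ₘ e.σ) = 0 := by linarith
  have hmi : ∀ (i : Fin 3) (c : ℝ), Integrable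
      (fun m => (M i).indicator (fun m => posteriorMean e m - c) m) (E.messageLaw e) := by
    intro i c
    refine Integrable.indicator ?_ (mM i)
    refine Integrable.sub ?_ (integrable_const c)
    exact Integrable.of_bound (C := 1) (measurable_posteriorMean e).aestronglyMeasurable
      (Filter.Eventually.of_forall fun m => by
        rw [Real.norm_eq_abs, abs_of_nonneg (posteriorMean_mem e m).1]
        exact (posteriorMean_mem e m).2)
  have ae1 := (integral_eq_zero_iff_of_nonneg n1 (hmi 1 _)).1 z1
  have ae2 := (integral_eq_zero_iff_of_nonneg n2 (hmi 2 _)).1 z2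
  have ae3 := (integral_eq_zero_iff_of_nonneg_ae nn (iPrice.sub iPay)).1 z3
  have hsame : ∀ᵐ q ∂(E.prior ⊗ₘ e.σ), (q.2 ∈ M 1 ↔ q.1 ∈ states (Icc h (E.γ 2))) ∧
      (q.2 ∈ M 2 ↔ q.1 ∈ states (Icc y h ∪ Icc (E.γ 2) 1)) := by
    filter_upwards [hae, ae3] with q hq hq3
    exact hq.2 (sub_eq_zero.1 hq3).symm
  -- Messages with payoff 0 could still have mean exactly or above γ₁. Their states lie outside both
  -- upper pools, hence at or below γ₁, so such messages are null.
  have ae0 : ∀ᵐ m ∂(E.messageLaw e),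
      m ∉ ((M 1)ᶜ ∩ (M 2)ᶜ) ∩ posteriorMean e ⁻¹' Ici (E.γ 1) := by
    refine he.ae_notMem_of_mean ((((mM 1).compl).inter (mM 2).compl).inter
      (measurable_posteriorMean e measurableSet_Ici)) (fun m hm => hm.2) ?_
    filter_upwards [hsame] with q hq hqS
    by_contra hlt
    have hlt' := not_le.1 hlt
    have c1 : q.1 ∉ states (Icc h (E.γ 2)) := fun hc => hqS.1.1 (hq.1.2 hc)
    have c2 : q.1 ∉ states (Icc y h ∪ Icc (E.γ 2) 1) := fun hc => hqS.1.2 (hq.2.2 hc)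
    rcases le_total (q.1 : ℝ) (E.γ 2) with hc | hc
    · exact c1 ⟨(hB.h_lt.trans hlt').le, hc⟩
    · exact c2 (Or.inr ⟨hc, q.1.2.2⟩)
  have law1 : E.messageLaw e (M 1) = E.prior (states (Icc h (E.γ 2))) := by
    rw [messageLaw_apply (mM 1), prior_apply_eq_joint (e := e) m1]
    refine measure_congr ?_
    filter_upwards [hsame] with q hq using propext hq.1
  have law2 : E.messageLaw e (M 2) = E.prior (states (Icc y h ∪ Icc (E.γ 2) 1)) := by
    rw [messageLaw_apply (mM 2), prior_apply_eq_joint (e := e) m2]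
    refine measure_congr ?_
    filter_upwards [hsame] with q hq using propext hq.2
  ext s hs
  have hmeas := measurable_posteriorMean e (hs.inter (measurableSet_Ici (a := E.γ 1)))
  rw [Measure.restrict_apply hs]
  change Measure.map (posteriorMean e) (E.messageLaw e) _ = _
  rw [Measure.map_apply (measurable_posteriorMean e) (hs.inter measurableSet_Ici),
    ← lintegral_indicator_one hmeas]
  -- Zero slack puts the posterior mean at γ₁ on `M 1` and at γ₂ on `M 2`, and no other message
  -- reaches γ₁.
  have hcalc : ∫⁻ m, (posteriorMean e ⁻¹' (s ∩ Ici (E.γ 1))).indicator 1 m ∂(E.messageLaw e) =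
      ∫⁻ m, ((M 1).indicator (fun _ => s.indicator (1 : ℝ → ℝ≥0∞) (E.γ 1)) m +
        (M 2).indicator (fun _ => s.indicator (1 : ℝ → ℝ≥0∞) (E.γ 2)) m) ∂(E.messageLaw e) := by
    refine lintegral_congr_ae ?_
    filter_upwards [ae0, ae1, ae2] with m h0 h1 h2
    by_cases hm1 : m ∈ M 1
    · have hm2 : m ∉ M 2 := fun hm2 => hv2.ne (Eq.trans (Eq.symm hm1) hm2)
      simp only [hm1, indicator_of_mem, Pi.zero_apply, sub_eq_zero] at h1
      simp [hm1, hm2, indicator_apply, h1]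
    · by_cases hm2 : m ∈ M 2
      · simp only [hm2, indicator_of_mem, Pi.zero_apply, sub_eq_zero] at h2
        simp [hm1, hm2, indicator_apply, h2, hB.cutoff_lt.le]
      · have : ¬ E.γ 1 ≤ posteriorMean e m := fun hc => h0 ⟨⟨hm1, hm2⟩, hc⟩
        simp [hm1, hm2, indicator_apply, this]
  rw [hcalc, lintegral_add_left (measurable_const.indicator (mM 1)),
    lintegral_indicator_const (mM 1), lintegral_indicator_const (mM 2), law1, law2]
  simp only [Measure.coe_add, Measure.coe_smul, Pi.add_apply, Pi.smul_apply, smul_eq_mul,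
    Measure.dirac_apply' _ hs]
  ring

end Environment

end

end VerifiableDisclosure

/-! ### The claim. -/

theorem claim2 (E : VerifiableDisclosure.Environment 3) :
    (∃ e, E.IsSenderPreferred e) ∧
    ((∀ e, E.IsSenderPreferred e → E.IsCommitmentOutcome (E.outcome e)) ∨
      ∃ h y : ℝ, 0 < h ∧ 0 ≤ y ∧ y ≤ h ∧ h < E.γ 2 ∧
        E.condMean (VerifiableDisclosure.states (Icc h (E.γ 2))) = E.γ 1 ∧
        E.condMean (VerifiableDisclosure.states (Icc y h ∪ Icc (E.γ 2) 1)) = E.γ 2 ∧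
        ∃ e, E.IsORE e (VerifiableDisclosure.nestedRep y h (E.γ 2)) ∧
          E.IsSenderPreferred e ∧
          ∀ e', E.IsSenderPreferred e' →
            (E.outcome e').1.restrict (Ici (E.γ 1)) =
              (E.outcome e).1.restrict (Ici (E.γ 1))) := by
  have H := E.isCumulative
  rcases H.nestedCommitment_or_binding E.cutoff_one_nonneg E.cutoff_one_le_two E.cutoff_two_le_one
    E.payoff_one_pos E.payoff_one_lt_two with ⟨y, h, g, hN, hR⟩ | ⟨y, h, hB⟩
  · rw [← VerifiableDisclosure.Environment.outcome_payoff_nested hN] at hR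
    have hpref := VerifiableDisclosure.Environment.senderPreferred_of_priceBound
      (VerifiableDisclosure.Environment.nestedSets_isObedient hN).isEquilibrium hR
    exact ⟨⟨_, hpref.1⟩, Or.inl hpref.2⟩
  · have hN := VerifiableDisclosure.Environment.isNested_of_binding hB
    have hO := VerifiableDisclosure.Environment.nestedSets_isObedient hN
    have hlt := hB.h_lt.trans hB.cutoff_lt
    have hval := VerifiableDisclosure.Environment.outcome_payoff_nested hN
    have hpref : E.IsSenderPreferred hO.assessment :=
      ⟨hO.isEquilibrium, fun e' he' => hval ▸ (he'.payoff_le_of_binding hB).1⟩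
    have hm1 := H.mass_lt (hB.nonneg.trans hB.y_lt.le) hlt hB.cutoff_lt_one.le
    have hm2 := H.mass_lt (hB.nonneg.trans (hB.y_lt.le.trans hlt.le)) hB.cutoff_lt_one le_rfl
    have hm3 := H.mass_le hB.nonneg hB.y_lt.le (hlt.le.trans hB.cutoff_lt_one.le)
    rw [H.mass_one] at hm2
    refine ⟨⟨_, hpref⟩, Or.inr ⟨h, y, hB.nonneg.trans_lt hB.y_lt, hB.nonneg, hB.y_lt.le, hlt, ?_, ?_,
      hO.assessment, ?_, hpref, fun e' he' => ?_⟩⟩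
    · rw [E.condMean_eq, E.real_states_Icc hlt.le, E.integral_states_Icc hlt.le, hB.middle]
      field_simp [(by linarith : E.mass (E.γ 2) - E.mass h ≠ 0)]
    · have hne : E.mass h - E.mass y + 1 - E.mass (E.γ 2) ≠ 0 := by
        have : 0 < E.mass h - E.mass y + 1 - E.mass (E.γ 2) := by linarith
        exact this.ne'
      rw [E.condMean_eq, E.real_states_union hB.y_lt.le hlt.le hB.cutoff_lt_one.le,
        E.integral_states_union hB.y_lt.le hlt.le hB.cutoff_lt_one.le, hB.outer]
      field_simp
    · rw [← VerifiableDisclosure.nestedSets_eq hlt hB.cutoff_lt_one]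
      exact hO.isORE
    -- Both laws reduce to the same two atoms, at γ₁ and γ₂.
    · rw [(he'.1.payoff_le_of_binding hB).2 (hval ▸ he'.2 _ hO.isEquilibrium),
        (hO.isEquilibrium.payoff_le_of_binding hB).2 hval.ge]
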